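/- Throughout, ``simplicial $2$-complex'' means a finite connected simplicial complex of dimension at most $2$. For a group $G$, the simplicial complexity $\kappa(G)$ is the minimal number of $2$-simplices of a simplicial $2$-complex $X$ with $\pi_1(X)\cong G$ (and $\kappa(G)=\infty$ if there is no such $X$, that is, if $G$ is not finitely presentable). The free index of a finitely presentable group $G$ is the unique integer $n\ge 0$ such that $G\cong H*F_n$, where $F_n$ is the free group of rank $n$ and $H$ is a group that is not isomorphic to any free product $K*F_m$ with $m\ge 1$; so $G$ has free index zero if and only if it has no free factor $\mathbb{Z}$. For a positive integer $T$, let $\mathcal{G}_\kappa(T)$ be the set of isomorphism classes of groups $G$ of free index zero with $\kappa(G)\le T$, and let $\mathcal{A}_\kappa(T)\subset\mathcal{G}_\kappa(T)$ be the subset of isomorphism classes of finite abelian groups. **Theorem.** For every integer $T\ge 2$ the set $\mathcal{G}_\kappa(T)$ is finite, and $$\left[2^{\frac{T-3}{14}}\right]\le|\mathcal{A}_\kappa(T)|\le|\mathcal{G}_\kappa(T)|\le 2^{6T\log_2 T},$$ where $[x]$ denotes the integral part of the real number $x$. -/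

import Mathlib

namespace SimplicialComplexity

/-- The geometric realization of a simplicial complex `K` with finite vertex set `ι`: the set of all
points of the standard simplex spanned by `ι` (in barycentric coordinates) whose support is
contained in a face of `K`. It carries the topology induced from `ι → ℝ`. -/
def realization {ι : Type} [Fintype ι] (K : AbstractSimplicialComplex ι) : Set (ι → ℝ) :=
  {x | x ∈ stdSimplex ℝ ι ∧ ∃ s ∈ K.faces, ∀ v, v ∉ s → x v = 0}

/-- The number `s_k(K)` of `k`-simplices of a finite simplicial complex `K`. -/
noncomputable def numSimplices {ι : Type} [Fintype ι] (K : AbstractSimplicialComplex ι) (k : ℕ) :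
    ℕ :=
  {s : Finset ι | s ∈ K.faces ∧ s.card = k + 1}.ncard

/-- `K` is a (connected) simplicial complex of dimension at most two whose geometric realization
has fundamental group isomorphic to `G`. -/
def IsTwoComplexFor {ι : Type} [Fintype ι] (K : AbstractSimplicialComplex ι)
    (G : Type*) [Group G] : Prop :=
  (∀ s ∈ K.faces, s.card ≤ 3) ∧
    PathConnectedSpace (realization K) ∧
    ∃ x : realization K, Nonempty (FundamentalGroup (realization K) x ≃* G)

/-- The simplicial complexity `κ(G)`: the infimum of the number of `2`-simplices over all finite
simplicial `2`-complexes with fundamental group `G`. The infimum is taken in `ℕ∞`, so `κ(G) = ⊤`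
exactly when there is no such complex, i.e. when `G` is not finitely presentable. -/
noncomputable def kappa (G : Type*) [Group G] : ℕ∞ :=
  sInf {k : ℕ∞ | ∃ (ι : Type) (_ : Fintype ι) (K : AbstractSimplicialComplex ι),
    IsTwoComplexFor K G ∧ k = (numSimplices K 2 : ℕ∞)}

/-- `H` cannot be decomposed as a free product `K * F_n` with `n` positive. -/
def HasNoFreeFactor (H : Type) [Group H] : Prop :=
  ∀ (K : Type) [Group K] (n : ℕ), 0 < n → IsEmpty (H ≃* Monoid.Coprod K (FreeGroup (Fin n)))

/-- The free index of `G` is `n`: `G = H * F_n` where `H` itself cannot be decomposed as a free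
product `K * F_m` with `m` positive. -/
def HasFreeIndex (G : Type) [Group G] (n : ℕ) : Prop :=
  ∃ (H : Type) (_ : Group H),
    Nonempty (G ≃* Monoid.Coprod H (FreeGroup (Fin n))) ∧ HasNoFreeFactor H

/-- Isomorphism classes of groups. -/
abbrev GroupClass : Type 1 := Quotient (CategoryTheory.isIsomorphicSetoid GrpCat.{0})

/-- The isomorphism class of a group. -/
def groupClass (G : Type) [Group G] : GroupClass :=
  Quotient.mk (CategoryTheory.isIsomorphicSetoid GrpCat.{0}) (GrpCat.of G)

/-- `𝒢_κ(T)`: the isomorphism classes of groups `G` of free index zero with `κ(G) ≤ T`. -/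
def groupsUpTo (T : ℕ) : Set GroupClass :=
  {c | ∃ (G : Type) (_ : Group G), c = groupClass G ∧ HasFreeIndex G 0 ∧ kappa G ≤ (T : ℕ∞)}

/-- `𝒜_κ(T)`: the subset of `𝒢_κ(T)` corresponding to finite abelian groups. -/
def abelianGroupsUpTo (T : ℕ) : Set GroupClass :=
  {c | c ∈ groupsUpTo T ∧
    ∃ (G : Type) (_ : Group G), c = groupClass G ∧ Finite G ∧ ∀ a b : G, a * b = b * a}

end SimplicialComplexity

/-!
The fundamental group of a connected complex is its edge group: generated by the edges, with the
edges of a spanning tree killed and one relation for each triangle. Simplicial approximation of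
loops shows that the edges generate. Conversely, the edge group acts on itself by left
multiplication, and the bundle over the realization which is trivial over the open stars and glued
along the edges by this action is a covering; its monodromy recovers every element of the edge
group.

An edge outside all triangles and outside the spanning tree is a free generator. Hence a group of
free index zero is already the edge group of the family of triangles, relative to a spanning forest
of their `1`-skeleton, and is determined by at most `T` triples of at most `3 * T` vertices. There
are at most `((3 * T).choose 3 + 1) ^ T` such families.

For the lower bound, the cyclic group of order `m` is the fundamental group of a telescope with one
stage for each binary digit of `m` after the leading one. The stage turns a loop representing the
multiple `h` of a generator into one representing `2 * h` or `2 * h + 1`, by Horner's scheme, at the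
cost of at most `12` triangles; closing the top kills the multiple `m`.
-/

namespace SimplicialComplexity

open unitInterval

section Paths

variable {X : Type*} [TopologicalSpace X] {x y z x' y' z' : X}

lemma trans_forall {p : Path x y} {q : Path y z} {P : X → Prop}
    (hp : ∀ t, P (p t)) (hq : ∀ t, P (q t)) (t : I) : P (p.trans q t) := by
  rw [Path.trans_apply]
  split_ifs
  exacts [hp _, hq _]

lemma trans_forall₂ {p : Path x y} {q : Path y z} {p' : Path x' y'} {q' : Path y' z'}
    {R : X → X → Prop} (hp : ∀ t, R (p t) (p' t)) (hq : ∀ t, R (q t) (q' t)) (t : I) :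
    R (p.trans q t) (p'.trans q' t) := by
  simp only [Path.trans_apply]
  split_ifs
  exacts [hp _, hq _]

lemma symm_trans_cancel_left (p : Path.Homotopic.Quotient x y)
    (q : Path.Homotopic.Quotient y z) : p.symm.trans (p.trans q) = q := by
  rw [← Path.Homotopic.Quotient.trans_assoc, Path.Homotopic.Quotient.symm_trans,
    Path.Homotopic.Quotient.refl_trans]

theorem quotient_induction_of_open_cover {κ : Type*} {U : κ → Set X} (hU : ∀ i, IsOpen (U i))
    (hcover : ⋃ i, U i = Set.univ) {P : ∀ {x y : X}, Path.Homotopic.Quotient x y → Prop}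
    (hsmall : ∀ {x y : X} (p : Path x y) (i : κ), (∀ t, p t ∈ U i) →
      P (Path.Homotopic.Quotient.mk p))
    (htrans : ∀ {x y z : X} (p : Path.Homotopic.Quotient x y) (q : Path.Homotopic.Quotient y z),
      P p → P q → P (p.trans q))
    (p : Path.Homotopic.Quotient x y) : P p := by
  induction p using Path.Homotopic.Quotient.ind with | _ p
  obtain ⟨t, ht0, htm, ⟨n, hn⟩, ht⟩ := exists_monotone_Icc_subset_open_cover_unitInterval
    (c := fun i => p ⁻¹' U i) (fun i => (hU i).preimage p.continuous)
    (by rw [← Set.preimage_iUnion, hcover, Set.preimage_univ])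
  have hstep : ∀ k, P (Path.Homotopic.Quotient.mk (p.subpath (t k) (t (k + 1)))) := by
    intro k
    obtain ⟨i, hi⟩ := ht k
    refine hsmall _ i fun u => ?_
    have hmem : p.subpath (t k) (t (k + 1)) u ∈ Set.range (p.subpath (t k) (t (k + 1))) := ⟨u, rfl⟩
    rw [Path.range_subpath_of_le _ _ _ (htm k.le_succ)] at hmem
    obtain ⟨s, hs, hsu⟩ := hmem
    exact hsu ▸ hi hs
  have hinit : ∀ k, P (Path.Homotopic.Quotient.mk (p.subpath (t 0) (t (k + 1)))) := by
    intro k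
    induction k with
    | zero => exact hstep 0
    | succ k ih =>
      rw [← Path.Homotopic.Quotient.eq.2 ⟨Path.Homotopy.subpathTransSubpath p (t 0) (t (k + 1))
        (t (k + 1 + 1))⟩, Path.Homotopic.Quotient.mk_trans]
      exact htrans _ _ ih (hstep _)
  have hp := hinit n
  rw [ht0, hn (n + 1) n.le_succ, Path.subpath_zero_one] at hp
  have hcast : ∀ {x' y' : X} (hx : x' = x) (hy : y' = y),
      P (Path.Homotopic.Quotient.mk (p.cast hx hy)) → P (Path.Homotopic.Quotient.mk p) := by
    rintro _ _ rfl rfl h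
    exact h
  exact hcast _ _ hp

end Paths

section Segments

variable {E : Type*} [AddCommGroup E] [Module ℝ E] [TopologicalSpace E] [IsTopologicalAddGroup E]
  [ContinuousSMul ℝ E] {A C : Set E} {x y z : A}

lemma homotopic_of_segment_subset (p q : Path x y) (h : ∀ t, segment ℝ (p t : E) (q t) ⊆ A) :
    p.Homotopic q :=
  ⟨{ toFun := fun st => ⟨AffineMap.lineMap (p st.2 : E) (q st.2 : E) (st.1 : ℝ),
        h _ (lineMap_mem_segment ℝ _ _ st.1.2)⟩
     continuous_toFun := by fun_prop
     map_zero_left := by simp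
     map_one_left := by simp
     prop' := by
      rintro s t (rfl | rfl) <;> simp }⟩

/-- The straight path between two points of a subset of a vector space, given that the segment
spanned by them lies in the subset. -/
def segPath (x y : A) (h : segment ℝ (x : E) y ⊆ A) : Path x y where
  toFun t := ⟨AffineMap.lineMap (x : E) (y : E) (t : ℝ), h (lineMap_mem_segment ℝ _ _ t.2)⟩
  continuous_toFun := by fun_prop
  source' := by simp
  target' := by simp

/-- The homotopy class of a straight path. -/
def segClass (x y : A) (h : segment ℝ (x : E) y ⊆ A) : Path.Homotopic.Quotient x y :=
  Path.Homotopic.Quotient.mk (segPath x y h)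

lemma segPath_mem_segment (h : segment ℝ (x : E) y ⊆ A) (t : I) :
    (segPath x y h t : E) ∈ segment ℝ (x : E) y :=
  lineMap_mem_segment ℝ _ _ t.2

lemma segClass_self (h : segment ℝ (x : E) x ⊆ A) :
    segClass x x h = Path.Homotopic.Quotient.refl x :=
  congrArg _ (Path.ext <| funext fun t => Subtype.ext <| by simp [segPath])

lemma segClass_trans (hC : Convex ℝ C) (hCA : C ⊆ A) (hx : (x : E) ∈ C) (hy : (y : E) ∈ C)
    (hz : (z : E) ∈ C) (hxy : segment ℝ (x : E) y ⊆ A) (hyz : segment ℝ (y : E) z ⊆ A)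
    (hxz : segment ℝ (x : E) z ⊆ A) :
    (segClass x y hxy).trans (segClass y z hyz) = segClass x z hxz := by
  refine Path.Homotopic.Quotient.eq.2 (homotopic_of_segment_subset _ _ fun t => ?_)
  refine (hC.segment_subset ?_ (hC.segment_subset hx hz (segPath_mem_segment hxz t))).trans hCA
  exact trans_forall (P := fun w : A => (w : E) ∈ C)
    (fun t => hC.segment_subset hx hy (segPath_mem_segment hxy t))
    (fun t => hC.segment_subset hy hz (segPath_mem_segment hyz t)) t

lemma segClass_trans_symm (hxy : segment ℝ (x : E) y ⊆ A) (hyx : segment ℝ (y : E) x ⊆ A) :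
    (segClass x y hxy).trans (segClass y x hyx) = Path.Homotopic.Quotient.refl x := by
  have hx : segment ℝ (x : E) x ⊆ A := by simp
  rw [segClass_trans (convex_segment _ _) hxy (left_mem_segment ℝ _ _) (right_mem_segment ℝ _ _)
    (left_mem_segment ℝ _ _) hxy hyx hx, segClass_self]

lemma segClass_trans_cancel (hxy : segment ℝ (x : E) y ⊆ A) (hyx : segment ℝ (y : E) x ⊆ A)
    (q : Path.Homotopic.Quotient x z) :
    (segClass x y hxy).trans ((segClass y x hyx).trans q) = q := by
  rw [← Path.Homotopic.Quotient.trans_assoc, segClass_trans_symm,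
    Path.Homotopic.Quotient.refl_trans]

lemma mk_eq_segClass_trans_of_star (p : Path x y) (c : A)
    (h : ∀ t, segment ℝ (p t : E) c ⊆ A) (hx : segment ℝ (x : E) c ⊆ A)
    (hy : segment ℝ (c : E) y ⊆ A) :
    Path.Homotopic.Quotient.mk p = (segClass x c hx).trans (segClass c y hy) := by
  have key : ((Path.refl x).trans (p.trans (Path.refl y))).Homotopic
      ((segPath x c hx).trans ((Path.refl c).trans (segPath c y hy))) := by
    refine homotopic_of_segment_subset _ _ (trans_forall₂
      (R := fun u w : A => segment ℝ (u : E) w ⊆ A) (fun t => ?_) (trans_forall₂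
      (R := fun u w : A => segment ℝ (u : E) w ⊆ A) h fun t => ?_))
    · exact ((convex_segment _ _).segment_subset (left_mem_segment ℝ _ _)
        (segPath_mem_segment hx t)).trans hx
    · exact ((convex_segment _ _).segment_subset (right_mem_segment ℝ _ _)
        (segPath_mem_segment hy t)).trans hy
  simpa only [segClass, Path.Homotopic.Quotient.mk_trans, Path.Homotopic.Quotient.mk_refl,
    Path.Homotopic.Quotient.refl_trans, Path.Homotopic.Quotient.trans_refl]
    using Path.Homotopic.Quotient.eq.2 key

end Segments

section Skeleton

variable {V : Type*} {S : Set (Finset V)} {a b : V}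

/-- Two vertices are cofacial in a family `S` of simplices if they lie in a common member of `S`.
A vertex is cofacial with itself as soon as it belongs to some member. -/
def Cofacial (S : Set (Finset V)) (a b : V) : Prop :=
  ∃ s ∈ S, a ∈ s ∧ b ∈ s

lemma Cofacial.symm : Cofacial S a b → Cofacial S b a
  | ⟨s, hs, ha, hb⟩ => ⟨s, hs, hb, ha⟩

/-- The `1`-skeleton of a family of simplices, as a simple graph. -/
def skeletonGraph (S : Set (Finset V)) : SimpleGraph V where
  Adj a b := a ≠ b ∧ Cofacial S a b
  symm := ⟨fun _ _ h => ⟨h.1.symm, h.2.symm⟩⟩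
  loopless := ⟨fun _ h => h.1 rfl⟩

lemma Cofacial.reachable (h : Cofacial S a b) : (skeletonGraph S).Reachable a b := by
  by_cases hab : a = b
  · exact hab ▸ .rfl
  · exact SimpleGraph.Adj.reachable ⟨hab, h⟩

end Skeleton

section Realization

lemma pos_of_mem_segment {κ : Type*} {i : κ} {x y z : κ → ℝ} (hx : 0 < x i) (hy : 0 < y i)
    (hz : z ∈ segment ℝ x y) : 0 < z i :=
  ((convex_Ioi 0).linear_preimage (LinearMap.proj (R := ℝ) (φ := fun _ : κ => ℝ) i)).segment_subset
    hx hy hz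

variable {ι : Type} [Fintype ι] {K : AbstractSimplicialComplex ι} {s : Finset ι} {a b v : ι}

/-- The closed simplex spanned by a set of vertices, in barycentric coordinates. -/
def closedFace (s : Finset ι) : Set (ι → ℝ) :=
  {x ∈ stdSimplex ℝ ι | ∀ v ∉ s, x v = 0}

lemma convex_closedFace (s : Finset ι) : Convex ℝ (closedFace s) := by
  refine (convex_stdSimplex ℝ ι).inter fun x hx y hy p q _ _ _ v hv => ?_
  simp [hx v hv, hy v hv]

lemma closedFace_subset_realization (hs : s ∈ K.faces) : closedFace s ⊆ realization K :=
  fun _ hx => ⟨hx.1, s, hs, hx.2⟩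

lemma exists_mem_closedFace (x : realization K) : ∃ s ∈ K.faces, (x : ι → ℝ) ∈ closedFace s :=
  let ⟨s, hs, h⟩ := x.2.2
  ⟨s, hs, x.2.1, h⟩

lemma mem_of_pos {x : ι → ℝ} (hx : x ∈ closedFace s) (hv : 0 < x v) : v ∈ s :=
  by_contra fun h => hv.ne' (hx.2 v h)

lemma cofacial_of_pos {x : realization K} (ha : 0 < x.1 a) (hb : 0 < x.1 b) :
    Cofacial K.faces a b :=
  let ⟨s, hs, hx⟩ := exists_mem_closedFace x
  ⟨s, hs, mem_of_pos hx ha, mem_of_pos hx hb⟩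

lemma exists_pos (x : realization K) : ∃ v, 0 < x.1 v := by
  by_contra! h
  have hsum := x.2.1.2
  rw [Finset.sum_eq_zero fun v _ => le_antisymm (h v) (x.2.1.1 v)] at hsum
  exact zero_ne_one hsum

/-- The open star of a vertex: the points of the realization with positive coordinate there. -/
def openStar (K : AbstractSimplicialComplex ι) (v : ι) : Set (realization K) :=
  {x | 0 < x.1 v}

lemma isOpen_openStar (v : ι) : IsOpen (openStar K v) :=
  isOpen_lt continuous_const ((continuous_apply v).comp continuous_subtype_val)

lemma iUnion_openStar : ⋃ v, openStar K v = Set.univ :=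
  Set.iUnion_eq_univ_iff.2 exists_pos

open Classical in
variable (K) in
/-- A vertex, as a point of the realization. -/
noncomputable def vertex (v : ι) : realization K :=
  ⟨Pi.single v 1, single_mem_stdSimplex ℝ v, {v}, K.singleton_mem v, fun w hw => by
    rw [Pi.single_eq_of_ne (by simpa using hw)]⟩

lemma vertex_apply_self (v : ι) : (vertex K v).1 v = 1 := by simp [vertex]

lemma vertex_apply_of_ne (h : b ≠ a) : (vertex K a).1 b = 0 := by simp [vertex, h]

lemma vertex_mem_openStar (v : ι) : vertex K v ∈ openStar K v :=
  one_pos.trans_eq (vertex_apply_self v).symm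

lemma eq_of_vertex_mem_openStar (h : vertex K a ∈ openStar K b) : b = a :=
  by_contra fun hne => h.ne' (vertex_apply_of_ne hne)

lemma vertex_mem_closedFace (ha : a ∈ s) : (vertex K a : ι → ℝ) ∈ closedFace s :=
  ⟨(vertex K a).2.1, fun _ hv => vertex_apply_of_ne fun h => hv (h ▸ ha)⟩

lemma segment_subset_realization (hs : s ∈ K.faces) {x y : ι → ℝ} (hx : x ∈ closedFace s)
    (hy : y ∈ closedFace s) : segment ℝ x y ⊆ realization K :=
  ((convex_closedFace s).segment_subset hx hy).trans (closedFace_subset_realization hs)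

lemma segment_vertex_vertex_subset (h : Cofacial K.faces a b) :
    segment ℝ (vertex K a : ι → ℝ) (vertex K b) ⊆ realization K :=
  let ⟨_, hs, ha, hb⟩ := h
  segment_subset_realization hs (vertex_mem_closedFace ha) (vertex_mem_closedFace hb)

lemma segment_vertex_subset {x : realization K} (h : x ∈ openStar K v) :
    segment ℝ (x : ι → ℝ) (vertex K v) ⊆ realization K :=
  let ⟨_, hs, hx⟩ := exists_mem_closedFace x
  segment_subset_realization hs hx (vertex_mem_closedFace (mem_of_pos hx h))

lemma segment_vertex_subset' {x : realization K} (h : x ∈ openStar K v) :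
    segment ℝ (vertex K v : ι → ℝ) x ⊆ realization K :=
  segment_symm ℝ (x : ι → ℝ) (vertex K v) ▸ segment_vertex_subset h

lemma exists_mem_closedFace_mem_openStar (hs : s ∈ K.faces) (ha : a ∈ s) (hb : b ∈ s) :
    ∃ m : realization K, (m : ι → ℝ) ∈ closedFace s ∧ m ∈ openStar K a ∧ m ∈ openStar K b := by
  have hm : midpoint ℝ (vertex K a : ι → ℝ) (vertex K b) ∈ closedFace s :=
    (convex_closedFace s).midpoint_mem (vertex_mem_closedFace ha) (vertex_mem_closedFace hb)
  have ha₀ := (vertex K a).2.1.1 b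
  have hb₀ := (vertex K b).2.1.1 a
  have ha₁ := vertex_apply_self (K := K) a
  have hb₁ := vertex_apply_self (K := K) b
  refine ⟨⟨_, closedFace_subset_realization hs hm⟩, hm, ?_, ?_⟩ <;>
    · simp only [openStar, Set.mem_ofPred_eq, midpoint_eq_smul_add, Pi.smul_apply, Pi.add_apply,
        smul_eq_mul, invOf_eq_inv]
      linarith

lemma connected_skeletonGraph [PathConnectedSpace (realization K)] :
    (skeletonGraph K.faces).Connected := by
  choose near hnear using exists_pos (K := K)
  let component (x : realization K) := (skeletonGraph K.faces).connectedComponentMk (near x)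
  have component_eq : ∀ v, ∀ x ∈ openStar K v,
      component x = (skeletonGraph K.faces).connectedComponentMk v := fun v x hx =>
    SimpleGraph.ConnectedComponent.eq.2 (cofacial_of_pos (hnear x) hx).reachable
  have component_const : IsLocallyConstant component :=
    IsLocallyConstant.iff_exists_open _ |>.2 fun x => ⟨openStar K (near x), isOpen_openStar _,
      hnear x, fun y hy => component_eq _ y hy⟩
  have : Nonempty ι := ⟨near (Classical.arbitrary _)⟩
  refine ⟨fun a b => SimpleGraph.ConnectedComponent.eq.1 ?_⟩
  rw [← component_eq a _ (vertex_mem_openStar a), ← component_eq b _ (vertex_mem_openStar b)]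
  exact component_const.apply_eq_of_preconnectedSpace _ _

end Realization

section EdgeGroup

variable {V : Type*} (S : Set (Finset V)) (T : SimpleGraph V)

/-- The relators of the edge group: an ordered pair of vertices which is an edge of `T`, or which is
not cofacial, is trivial; and the edges of a simplex compose. -/
def edgeRelators : Set (FreeGroup (V × V)) :=
  {r | ∃ a b, (T.Adj a b ∨ ¬Cofacial S a b) ∧ r = FreeGroup.of (a, b)} ∪
  {r | ∃ s ∈ S, ∃ a ∈ s, ∃ b ∈ s, ∃ c ∈ s,
    r = FreeGroup.of (a, b) * FreeGroup.of (b, c) * (FreeGroup.of (a, c))⁻¹}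

/-- The edge group of a family `S` of simplices relative to a forest `T`. All ordered pairs of
vertices are generators; killing the pairs which are not cofacial leaves the oriented edges. -/
def EdgeGroup : Type _ := PresentedGroup (edgeRelators S T)

instance : Group (EdgeGroup S T) := inferInstanceAs (Group (PresentedGroup (edgeRelators S T)))

/-- The generator of the edge group given by an ordered pair of vertices. -/
def edge (a b : V) : EdgeGroup S T := PresentedGroup.of (a, b)

/-- The cocycle condition for a function on ordered pairs of vertices, imposed on the triples of
vertices of each simplex. -/
def IsCocycle {G : Type*} [Mul G] (f : V → V → G) : Prop :=
  ∀ s ∈ S, ∀ a ∈ s, ∀ b ∈ s, ∀ c ∈ s, f a b * f b c = f a c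

variable {S T} {G : Type*} [Group G] {a b : V}

lemma isCocycle_edge : IsCocycle S (edge S T) := fun s hs a ha b hb c hc =>
  mul_inv_eq_one.1 (PresentedGroup.one_of_mem (Or.inr ⟨s, hs, a, ha, b, hb, c, hc, rfl⟩))

lemma edge_of_adj (h : T.Adj a b) : edge S T a b = 1 :=
  PresentedGroup.one_of_mem (Or.inl ⟨a, b, Or.inl h, rfl⟩)

lemma edge_of_not_cofacial (h : ¬Cofacial S a b) : edge S T a b = 1 :=
  PresentedGroup.one_of_mem (Or.inl ⟨a, b, Or.inr h, rfl⟩)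

lemma IsCocycle.self {f : V → V → G} (hf : IsCocycle S f) (h : Cofacial S a a) : f a a = 1 :=
  let ⟨s, hs, ha, _⟩ := h
  mul_eq_left.1 (hf s hs a ha a ha a ha)

lemma IsCocycle.symm {f : V → V → G} (hf : IsCocycle S f) (h : Cofacial S a b) :
    f b a = (f a b)⁻¹ := by
  obtain ⟨s, hs, ha, hb⟩ := h
  rw [eq_inv_iff_mul_eq_one, hf s hs b hb a ha b hb, hf.self ⟨s, hs, hb, hb⟩]

lemma edge_self (a : V) : edge S T a a = 1 := by
  by_cases h : Cofacial S a a
  · exact isCocycle_edge.self h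
  · exact edge_of_not_cofacial h

lemma edge_symm (a b : V) : edge S T b a = (edge S T a b)⁻¹ := by
  by_cases h : Cofacial S a b
  · exact isCocycle_edge.symm h
  · rw [edge_of_not_cofacial h, edge_of_not_cofacial (mt Cofacial.symm h), inv_one]

open Classical in
/-- The homomorphism out of the edge group induced by a cocycle which is trivial on `T`. Only the
values of the cocycle on cofacial pairs matter. -/
noncomputable def EdgeGroup.lift (f : V → V → G) (hf : IsCocycle S f)
    (hT : ∀ a b, Cofacial S a b → T.Adj a b → f a b = 1) : EdgeGroup S T →* G :=
  PresentedGroup.toGroup (f := fun p : V × V => if Cofacial S p.1 p.2 then f p.1 p.2 else 1) (by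
    rintro r (⟨a, b, h, rfl⟩ | ⟨s, hs, a, ha, b, hb, c, hc, rfl⟩)
    · rw [FreeGroup.lift_apply_of, ite_eq_right_iff]
      exact fun hab => hT a b hab (h.resolve_right (not_not.2 hab))
    · have hab : Cofacial S a b := ⟨s, hs, ha, hb⟩
      have hbc : Cofacial S b c := ⟨s, hs, hb, hc⟩
      have hac : Cofacial S a c := ⟨s, hs, ha, hc⟩
      simp only [map_mul, map_inv, FreeGroup.lift_apply_of, if_pos hab, if_pos hbc, if_pos hac,
        hf s hs a ha b hb c hc, mul_inv_cancel])

lemma EdgeGroup.lift_edge {f : V → V → G} (hf : IsCocycle S f)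
    (hT : ∀ a b, Cofacial S a b → T.Adj a b → f a b = 1) (h : Cofacial S a b) :
    EdgeGroup.lift f hf hT (edge S T a b) = f a b :=
  (PresentedGroup.toGroup.of _).trans (if_pos h)

lemma EdgeGroup.hom_ext {φ ψ : EdgeGroup S T →* G}
    (h : ∀ a b, Cofacial S a b → φ (edge S T a b) = ψ (edge S T a b)) : φ = ψ := by
  refine PresentedGroup.ext fun ⟨a, b⟩ => ?_
  change φ (edge S T a b) = ψ (edge S T a b)
  by_cases hab : Cofacial S a b
  · exact h a b hab
  · rw [edge_of_not_cofacial hab, map_one, map_one]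

end EdgeGroup

section EdgePaths

variable {ι : Type} [Fintype ι] {K : AbstractSimplicialComplex ι} {T : SimpleGraph ι}

/-- The homotopy class of the edge path from `a` to `b`. -/
noncomputable def edgeClass {a b : ι} (h : Cofacial K.faces a b) :
    Path.Homotopic.Quotient (vertex K a) (vertex K b) :=
  segClass _ _ (segment_vertex_vertex_subset h)

lemma edgeClass_trans {s : Finset ι} (hs : s ∈ K.faces) {a b c : ι} (ha : a ∈ s) (hb : b ∈ s)
    (hc : c ∈ s) (hab : Cofacial K.faces a b) (hbc : Cofacial K.faces b c)
    (hac : Cofacial K.faces a c) :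
    (edgeClass hab).trans (edgeClass hbc) = edgeClass hac :=
  segClass_trans (convex_closedFace s) (closedFace_subset_realization hs)
    (vertex_mem_closedFace ha) (vertex_mem_closedFace hb) (vertex_mem_closedFace hc) _ _ _

lemma segClass_trans_segClass_vertex {x : realization K} {a b : ι} (ha : x ∈ openStar K a)
    (hb : x ∈ openStar K b) :
    (segClass _ x (segment_vertex_subset' ha)).trans (segClass x _ (segment_vertex_subset hb)) =
      edgeClass (cofacial_of_pos ha hb) :=
  let ⟨s, hs, hxs⟩ := exists_mem_closedFace x
  segClass_trans (convex_closedFace s) (closedFace_subset_realization hs)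
    (vertex_mem_closedFace (mem_of_pos hxs ha)) hxs (vertex_mem_closedFace (mem_of_pos hxs hb))
    _ _ _

variable (hT : T ≤ skeletonGraph K.faces)

/-- The homotopy class of the edge path of a walk in a subgraph of the `1`-skeleton. -/
noncomputable def walkClass : {a b : ι} → T.Walk a b →
    Path.Homotopic.Quotient (vertex K a) (vertex K b)
  | _, _, .nil => Path.Homotopic.Quotient.refl _
  | _, _, .cons h p => (edgeClass (hT h).2).trans (walkClass p)

lemma walkClass_concat {a b c : ι} (p : T.Walk a b) (h : T.Adj b c) :
    walkClass hT (p.concat h) = (walkClass hT p).trans (edgeClass (hT h).2) := by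
  induction p with
  | nil =>
    simp only [SimpleGraph.Walk.concat_nil, walkClass, Path.Homotopic.Quotient.refl_trans,
      Path.Homotopic.Quotient.trans_refl]
  | cons h' p ih =>
    rw [SimpleGraph.Walk.concat_cons, walkClass, walkClass, ih, Path.Homotopic.Quotient.trans_assoc]

lemma pathConnectedSpace_of_connected_skeletonGraph (h : (skeletonGraph K.faces).Connected) :
    PathConnectedSpace (realization K) := by
  obtain ⟨v₀⟩ := h.nonempty
  have hjoined : ∀ x : realization K, Joined (vertex K v₀) x := fun x => by
    obtain ⟨a, ha⟩ := exists_pos x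
    obtain ⟨p⟩ := h.preconnected v₀ a
    exact Joined.trans ⟨Quotient.out (walkClass le_rfl p)⟩ ⟨segPath _ _ (segment_vertex_subset' ha)⟩
  exact ⟨⟨vertex K v₀⟩, fun x y => (hjoined x).symm.trans (hjoined y)⟩

end EdgePaths

section Monodromy

lemma monodromy_symm_eq_of_monodromy_eq {Y X : Type*} [TopologicalSpace Y] [TopologicalSpace X]
    {f : Y → X} (cov : IsCoveringMap f) {x y : X} {p : Path.Homotopic.Quotient x y}
    {e : f ⁻¹' {x}} {e' : f ⁻¹' {y}} (h : cov.monodromy p e = e') :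
    cov.monodromy p.symm e' = e := by
  rw [← h, ← cov.monodromy_trans_apply, Path.Homotopic.Quotient.trans_symm, cov.monodromy_refl, id]

variable {J B F : Type*} [TopologicalSpace B] [TopologicalSpace F] (Z : FiberBundleCore J B F)

/-- The fiber of a bundle over a point, identified with the model fiber through the preferred
trivialization at that point. -/
def fiberEquiv (x : B) : F ≃ Z.proj ⁻¹' {x} where
  toFun f := ⟨⟨x, f⟩, rfl⟩
  invFun z := z.1.2
  left_inv _ := rfl
  right_inv := by rintro ⟨⟨_, f⟩, rfl⟩; rfl

variable [DiscreteTopology F]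

lemma isCoveringMap_proj : IsCoveringMap Z.proj := FiberBundle.isCoveringMap

lemma monodromy_mk_of_mem_baseSet (i : J) {x y : B} (p : Path x y) (h : ∀ t, p t ∈ Z.baseSet i)
    (f : F) :
    (isCoveringMap_proj Z).monodromy (Path.Homotopic.Quotient.mk p) (fiberEquiv Z x f) =
      fiberEquiv Z y (Z.coordChange i (Z.indexAt y) y (Z.coordChange (Z.indexAt x) i x f)) := by
  set c := Z.coordChange (Z.indexAt x) i x f with hc
  let lift : B → Z.TotalSpace := fun b => ⟨b, Z.coordChange i (Z.indexAt b) b c⟩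
  have lift_start : lift x = ⟨x, f⟩ := by
    have hx : x ∈ Z.baseSet i := p.source ▸ h 0
    simp only [lift]
    rw [hc, Z.coordChange_comp, Z.coordChange_self]
    · exact Z.mem_baseSet_at x
    · exact ⟨⟨Z.mem_baseSet_at x, hx⟩, Z.mem_baseSet_at x⟩
  have lift_continuous : Continuous fun t => lift (p t) :=
    (Z.localTriv i).continuousOn_invFun.comp_continuous
      (p.continuous.prodMk continuous_const : Continuous fun t : I => (p t, c))
      fun t => ⟨h t, trivial⟩
  let liftedPath : Path (⟨x, f⟩ : Z.TotalSpace) (lift y) :=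
    { toFun := fun t => lift (p t)
      continuous_toFun := lift_continuous
      source' := by simp [lift_start]
      target' := by simp }
  exact (isCoveringMap_proj Z).monodromy_eq_of_map_eq (Path.Homotopic.Quotient.mk liftedPath) rfl

end Monodromy

section FlatBundle

variable {ι : Type} [Fintype ι] {K : AbstractSimplicialComplex ι}
  {G : Type*} [Group G] [TopologicalSpace G] [DiscreteTopology G] {g : ι → ι → G}
  (hg : IsCocycle K.faces g)

/-- The flat bundle over the realization with structure group `G` defined by a cocycle on the edges:
it is trivial over the open stars of the vertices, with constant coordinate changes. -/
noncomputable def flatBundle : FiberBundleCore ι (realization K) G where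
  baseSet := openStar K
  isOpen_baseSet := isOpen_openStar
  indexAt x := (exists_pos x).choose
  mem_baseSet_at x := (exists_pos x).choose_spec
  coordChange i j _ f := g j i * f
  coordChange_self i x hx f := by rw [hg.self (cofacial_of_pos hx hx), one_mul]
  continuousOn_coordChange i j :=
    ((continuous_of_discreteTopology (f := fun f : G => g j i * f)).comp
      continuous_snd).continuousOn
  coordChange_comp i j k x hx f := by
    obtain ⟨s, hs, hxs⟩ := exists_mem_closedFace x
    rw [← mul_assoc, hg s hs k (mem_of_pos hxs hx.2) j (mem_of_pos hxs hx.1.2) i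
      (mem_of_pos hxs hx.1.1)]

lemma indexAt_vertex (v : ι) : (flatBundle hg).indexAt (vertex K v) = v :=
  eq_of_vertex_mem_openStar ((flatBundle hg).mem_baseSet_at (vertex K v))

lemma monodromy_edgeClass {a b : ι} (h : Cofacial K.faces a b) (f : G) :
    (isCoveringMap_proj (flatBundle hg)).monodromy (edgeClass h)
      (fiberEquiv _ (vertex K a) f) = fiberEquiv _ (vertex K b) (g b a * f) := by
  obtain ⟨s, hs, ha, hb⟩ := id h
  obtain ⟨m, hms, hma, hmb⟩ := exists_mem_closedFace_mem_openStar hs ha hb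
  have hstart : ∀ t, segPath _ m (segment_vertex_subset' hma) t ∈ (flatBundle hg).baseSet a :=
    fun t => pos_of_mem_segment (vertex_mem_openStar a) hma (segPath_mem_segment _ t)
  have hend : ∀ t, segPath m _ (segment_vertex_subset hmb) t ∈ (flatBundle hg).baseSet b :=
    fun t => pos_of_mem_segment hmb (vertex_mem_openStar b) (segPath_mem_segment _ t)
  rw [← segClass_trans_segClass_vertex hma hmb, IsCoveringMap.monodromy_trans_apply, segClass,
    segClass, monodromy_mk_of_mem_baseSet _ a _ hstart, monodromy_mk_of_mem_baseSet _ b _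
    hend, indexAt_vertex, indexAt_vertex]
  congr 1
  set i := (flatBundle hg).indexAt m
  have hi : i ∈ s := mem_of_pos hms ((flatBundle hg).mem_baseSet_at m)
  change g b b * (g b i * (g i a * (g a a * f))) = g b a * f
  rw [hg.self ⟨s, hs, ha, ha⟩, hg.self ⟨s, hs, hb, hb⟩, one_mul, one_mul, ← mul_assoc,
    hg s hs b hb i hi a ha]

lemma monodromy_walkClass {T : SimpleGraph ι} (hT : T ≤ skeletonGraph K.faces)
    (hgT : ∀ a b, T.Adj a b → g a b = 1) {a b : ι} (p : T.Walk a b) (f : G) :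
    (isCoveringMap_proj (flatBundle hg)).monodromy (walkClass hT p)
      (fiberEquiv _ (vertex K a) f) = fiberEquiv _ (vertex K b) f := by
  induction p with
  | nil => rw [walkClass, IsCoveringMap.monodromy_refl, id]
  | cons h p ih =>
    rw [walkClass, IsCoveringMap.monodromy_trans_apply, monodromy_edgeClass, hgT _ _ h.symm,
      one_mul, ih]

end FlatBundle

section EdgeLoops

/-- Walks from a root to all vertices of a graph such that the walks to the two ends of each edge
differ by that edge; they exist in trees. -/
structure RootedWalks {V : Type*} (T : SimpleGraph V) (v₀ : V) where
  walk (a : V) : T.Walk v₀ a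
  concat {a b : V} (h : T.Adj a b) : walk b = (walk a).concat h ∨ walk a = (walk b).concat h.symm

lemma nonempty_rootedWalks {V : Type*} {T : SimpleGraph V} (hT : T.IsTree) (v₀ : V) :
    Nonempty (RootedWalks T v₀) := by
  choose w hw using fun a => (hT.existsUnique_path v₀ a).exists
  refine ⟨⟨w, fun {a b} h => ?_⟩⟩
  by_cases hb : b ∈ (w a).support
  · exact Or.inr (hT.isAcyclic.path_concat (hw b) (hw a) h.symm hb)
  · exact Or.inl ((hT.existsUnique_path v₀ b).unique (hw b) ((hw a).concat hb h))

variable {ι : Type} [Fintype ι] {K : AbstractSimplicialComplex ι} {T : SimpleGraph ι}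
  (hT : T ≤ skeletonGraph K.faces) {v₀ : ι} (w : RootedWalks T v₀)

/-- The loop at the root obtained by closing up a path between vertices along the rooted walks. -/
noncomputable def closeUp {a b : ι} (p : Path.Homotopic.Quotient (vertex K a) (vertex K b)) :
    FundamentalGroup (realization K) (vertex K v₀) :=
  ((walkClass hT (w.walk a)).trans p).trans (walkClass hT (w.walk b)).symm

lemma closeUp_trans {a b c : ι} (p : Path.Homotopic.Quotient (vertex K a) (vertex K b))
    (q : Path.Homotopic.Quotient (vertex K b) (vertex K c)) :
    closeUp hT w (p.trans q) = closeUp hT w q * closeUp hT w p := by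
  rw [FundamentalGroup.mul_def]
  simp only [closeUp, Path.Homotopic.Quotient.trans_assoc, symm_trans_cancel_left]

lemma closeUp_surjective : Function.Surjective (closeUp hT w (a := v₀) (b := v₀)) := fun p => by
  let q := walkClass hT (w.walk v₀)
  refine ⟨(q.symm.trans p).trans q, ?_⟩
  change (q.trans ((q.symm.trans p).trans q)).trans q.symm = p
  simp only [Path.Homotopic.Quotient.trans_assoc, Path.Homotopic.Quotient.trans_symm,
    Path.Homotopic.Quotient.trans_refl]
  rw [← Path.Homotopic.Quotient.trans_assoc, Path.Homotopic.Quotient.trans_symm,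
    Path.Homotopic.Quotient.refl_trans]

open Classical in
/-- The loop at the root through the edge from `b` to `a`. The order is reversed because the
product `p * q` in Mathlib's fundamental group traverses `q` first. -/
noncomputable def edgeLoop (a b : ι) : FundamentalGroup (realization K) (vertex K v₀) :=
  if h : Cofacial K.faces a b then closeUp hT w (edgeClass h.symm) else 1

lemma edgeLoop_of_cofacial {a b : ι} (h : Cofacial K.faces a b) :
    edgeLoop hT w a b = closeUp hT w (edgeClass h.symm) :=
  dif_pos h

lemma isCocycle_edgeLoop : IsCocycle K.faces (edgeLoop hT w) := by
  intro s hs a ha b hb c hc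
  rw [edgeLoop_of_cofacial hT w ⟨s, hs, ha, hb⟩, edgeLoop_of_cofacial hT w ⟨s, hs, hb, hc⟩,
    edgeLoop_of_cofacial hT w ⟨s, hs, ha, hc⟩, ← closeUp_trans, edgeClass_trans hs hc hb ha]

lemma edgeLoop_of_adj {a b : ι} (h : T.Adj a b) : edgeLoop hT w a b = 1 := by
  rw [edgeLoop_of_cofacial hT w (hT h).2, FundamentalGroup.one_def, closeUp]
  rcases w.concat h with hw | hw
  · rw [hw, walkClass_concat, Path.Homotopic.Quotient.trans_assoc (walkClass hT (w.walk a)),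
      edgeClass, edgeClass, segClass_trans_symm, Path.Homotopic.Quotient.trans_refl,
      Path.Homotopic.Quotient.trans_symm]
  · rw [hw, walkClass_concat, Path.Homotopic.Quotient.trans_symm]

/-- The homomorphism from the edge group to the fundamental group. -/
noncomputable def edgeToLoop :
    EdgeGroup K.faces T →* FundamentalGroup (realization K) (vertex K v₀) :=
  EdgeGroup.lift (edgeLoop hT w) (isCocycle_edgeLoop hT w) fun _ _ _ => edgeLoop_of_adj hT w

lemma edgeToLoop_edge {a b : ι} (h : Cofacial K.faces a b) :
    edgeToLoop hT w (edge _ _ a b) = closeUp hT w (edgeClass h.symm) :=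
  (EdgeGroup.lift_edge _ _ h).trans (edgeLoop_of_cofacial hT w h)

lemma closeUp_edgeClass_mem_range {a b : ι} (h : Cofacial K.faces a b) :
    closeUp hT w (edgeClass h) ∈ (edgeToLoop hT w).range :=
  ⟨edge _ _ b a, edgeToLoop_edge hT w h.symm⟩

/-- A path class is edge generated if, however its ends are joined to vertices of their carriers,
closing it up gives a loop in the image of the edge group. -/
def IsEdgeGenerated {x y : realization K} (p : Path.Homotopic.Quotient x y) : Prop :=
  ∀ a b (ha : x ∈ openStar K a) (hb : y ∈ openStar K b),
    closeUp hT w ((segClass _ _ (segment_vertex_subset' ha)).trans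
      (p.trans (segClass _ _ (segment_vertex_subset hb)))) ∈ (edgeToLoop hT w).range

variable {hT w}

lemma IsEdgeGenerated.trans {x y z : realization K} {p : Path.Homotopic.Quotient x y}
    {q : Path.Homotopic.Quotient y z} (hp : IsEdgeGenerated hT w p) (hq : IsEdgeGenerated hT w q) :
    IsEdgeGenerated hT w (p.trans q) := by
  intro a b ha hb
  obtain ⟨c, hc⟩ := exists_pos y
  have hmul := mul_mem (hq c b hc hb) (hp a c ha hc)
  rw [← closeUp_trans] at hmul
  simpa only [Path.Homotopic.Quotient.trans_assoc, segClass_trans_cancel] using hmul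

lemma isEdgeGenerated_mk_of_mem_openStar {x y : realization K} (p : Path x y) (v : ι)
    (h : ∀ t, p t ∈ openStar K v) : IsEdgeGenerated hT w (Path.Homotopic.Quotient.mk p) := by
  intro a b ha hb
  have hx : x ∈ openStar K v := p.source ▸ h 0
  have hy : y ∈ openStar K v := p.target ▸ h 1
  have hmul := mul_mem (closeUp_edgeClass_mem_range hT w (cofacial_of_pos hy hb))
    (closeUp_edgeClass_mem_range hT w (cofacial_of_pos ha hx))
  rw [← closeUp_trans, ← segClass_trans_segClass_vertex hy hb,
    ← segClass_trans_segClass_vertex ha hx] at hmul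
  rw [mk_eq_segClass_trans_of_star p _ (fun t => segment_vertex_subset (h t))
    (segment_vertex_subset hx) (segment_vertex_subset' hy)]
  simpa only [Path.Homotopic.Quotient.trans_assoc] using hmul

variable (hT w)

lemma edgeToLoop_surjective : Function.Surjective (edgeToLoop hT w) := by
  refine fun p => MonoidHom.mem_range.1 ?_
  obtain ⟨q, rfl⟩ := closeUp_surjective hT w p
  have hq : IsEdgeGenerated hT w q :=
    quotient_induction_of_open_cover (P := IsEdgeGenerated hT w) isOpen_openStar iUnion_openStar
      isEdgeGenerated_mk_of_mem_openStar (fun _ _ => IsEdgeGenerated.trans) q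
  have hv₀ := vertex_mem_openStar (K := K) v₀
  simpa only [segClass_self, Path.Homotopic.Quotient.refl_trans,
    Path.Homotopic.Quotient.trans_refl] using hq v₀ v₀ hv₀ hv₀

lemma monodromy_edgeToLoop {G : Type*} [Group G] [TopologicalSpace G] [DiscreteTopology G]
    {g : ι → ι → G} (hg : IsCocycle K.faces g) (hgT : ∀ a b, T.Adj a b → g a b = 1)
    (e : EdgeGroup K.faces T) (f : G) :
    (isCoveringMap_proj (flatBundle hg)).monodromy (edgeToLoop hT w e) (fiberEquiv _ _ f) =
      fiberEquiv _ _ (EdgeGroup.lift g hg (fun a b _ => hgT a b) e * f) := by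
  set cov := isCoveringMap_proj (flatBundle hg)
  set φ := EdgeGroup.lift g hg fun a b _ => hgT a b
  let F : G ≃ (flatBundle hg).proj ⁻¹' {vertex K v₀} := fiberEquiv _ _
  have key : (cov.monodromyPerm (vertex K v₀)).comp (edgeToLoop hT w) =
      F.permCongrHom.toMonoidHom.comp ((MulAction.toPermHom G G).comp φ) := by
    refine EdgeGroup.hom_ext fun a b h => Equiv.ext fun z => ?_
    obtain ⟨f, rfl⟩ := F.surjective z
    change cov.monodromy (edgeToLoop hT w (edge _ _ a b)) (F f) =
      F (φ (edge _ _ a b) * F.symm (F f))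
    rw [edgeToLoop_edge hT w h, closeUp, cov.monodromy_trans_apply, cov.monodromy_trans_apply,
      monodromy_walkClass hg hT hgT, monodromy_edgeClass,
      monodromy_symm_eq_of_monodromy_eq cov (monodromy_walkClass hg hT hgT _ _),
      EdgeGroup.lift_edge _ _ h, Equiv.symm_apply_apply]
  exact (DFunLike.congr_fun (DFunLike.congr_fun key e) (F f)).trans
    (congrArg (fun f' => F (φ e * f')) (F.symm_apply_apply f))

lemma edgeToLoop_injective : Function.Injective (edgeToLoop hT w) := by
  let _ : TopologicalSpace (EdgeGroup K.faces T) := ⊥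
  have _ : DiscreteTopology (EdgeGroup K.faces T) := ⟨rfl⟩
  have hlift : EdgeGroup.lift (edge K.faces T) isCocycle_edge (fun _ _ _ => edge_of_adj) =
      MonoidHom.id (EdgeGroup K.faces T) :=
    EdgeGroup.hom_ext fun _ _ h => EdgeGroup.lift_edge _ _ h
  refine (injective_iff_map_eq_one _).2 fun e he => ?_
  have hmon := monodromy_edgeToLoop hT w isCocycle_edge (fun _ _ => edge_of_adj) e 1
  rw [he, hlift, FundamentalGroup.one_def, IsCoveringMap.monodromy_refl, mul_one] at hmon
  exact ((fiberEquiv _ _).injective hmon).symm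

/-- The fundamental group of the realization is the edge group. -/
noncomputable def edgeGroupEquiv :
    EdgeGroup K.faces T ≃* FundamentalGroup (realization K) (vertex K v₀) :=
  MulEquiv.ofBijective (edgeToLoop hT w) ⟨edgeToLoop_injective hT w, edgeToLoop_surjective hT w⟩

end EdgeLoops

section Splitting

variable {V : Type*} {S D : Set (Finset V)} {T F : SimpleGraph V} {a b c : V}

lemma Cofacial.mono (hDS : D ⊆ S) : Cofacial D a b → Cofacial S a b
  | ⟨s, hs, h⟩ => ⟨s, hDS hs, h⟩

lemma IsCocycle.mono {G : Type*} [Mul G] {f : V → V → G} (hDS : D ⊆ S) (hf : IsCocycle S f) :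
    IsCocycle D f :=
  fun s hs => hf s (hDS hs)

lemma mul_eq_of_card_le_two {G : Type*} [Group G] {f : V → V → G} (hself : ∀ a, f a a = 1)
    (hsymm : ∀ a b, f b a = (f a b)⁻¹) {s : Finset V} (hs : s.card ≤ 2) (ha : a ∈ s) (hb : b ∈ s)
    (hc : c ∈ s) : f a b * f b c = f a c := by
  have hdup : a = b ∨ b = c ∨ a = c := by
    by_contra! h
    exact (Finset.two_lt_card.2 ⟨a, ha, b, hb, c, hc, h.1, h.2.2, h.2.1⟩).not_ge hs
  obtain rfl | rfl | rfl := hdup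
  · rw [hself, one_mul]
  · rw [hself, mul_one]
  · rw [hself, hsymm a b, mul_inv_cancel]

variable [LinearOrder V]

variable (S D T) in
/-- A pair of vertices is a free edge if it is an edge of `S` which lies neither in a member of `D`
nor in the forest `T`, oriented upwards. -/
def IsFreeEdge (a b : V) : Prop :=
  a < b ∧ Cofacial S a b ∧ ¬Cofacial D a b ∧ ¬T.Adj a b

variable (S D T) in
/-- The type of free edges, which index the free generators split off by passing from `D`
to `S`. -/
abbrev FreeEdge : Type _ := {p : V × V // IsFreeEdge S D T p.1 p.2}

open Classical in
variable (S D T) in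
/-- The free generator belonging to an oriented pair of vertices: trivial if neither orientation
is a free edge, and inverted if the opposite orientation is. -/
noncomputable def freeEdge (a b : V) : FreeGroup (FreeEdge S D T) :=
  if h : IsFreeEdge S D T a b then FreeGroup.of ⟨(a, b), h⟩
  else if h : IsFreeEdge S D T b a then (FreeGroup.of ⟨(b, a), h⟩)⁻¹
  else 1

lemma freeEdge_of_isFreeEdge (h : IsFreeEdge S D T a b) :
    freeEdge S D T a b = FreeGroup.of ⟨(a, b), h⟩ :=
  dif_pos h

lemma freeEdge_of_not_isFreeEdge (h : ¬IsFreeEdge S D T a b) (h' : ¬IsFreeEdge S D T b a) :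
    freeEdge S D T a b = 1 :=
  (dif_neg h).trans (dif_neg h')

lemma freeEdge_self (a : V) : freeEdge S D T a a = 1 :=
  have h : ¬IsFreeEdge S D T a a := fun h => h.1.false
  freeEdge_of_not_isFreeEdge h h

lemma freeEdge_symm (a b : V) : freeEdge S D T b a = (freeEdge S D T a b)⁻¹ := by
  unfold freeEdge
  split_ifs with h h' h'
  · exact absurd h.1 h'.1.asymm
  · exact (inv_inv _).symm
  · rfl
  · exact inv_one.symm

lemma freeEdge_of_adj (h : T.Adj a b) : freeEdge S D T a b = 1 :=
  freeEdge_of_not_isFreeEdge (fun h' => h'.2.2.2 h) fun h' => h'.2.2.2 h.symm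

open Classical in
/-- The cocycle on `S` which defines the splitting homomorphism: on the edges of `D` it is the
universal one, and every other edge outside the forest is sent to its free generator. -/
noncomputable def splitCocycle (S D : Set (Finset V)) (T F : SimpleGraph V) (a b : V) :
    Monoid.Coprod (EdgeGroup D F) (FreeGroup (FreeEdge S D T)) :=
  if Cofacial D a b then Monoid.Coprod.inl (edge D F a b)
  else Monoid.Coprod.inr (freeEdge S D T a b)

lemma splitCocycle_of_cofacial (h : Cofacial D a b) :
    splitCocycle S D T F a b = Monoid.Coprod.inl (edge D F a b) :=
  if_pos h

lemma splitCocycle_of_not_cofacial (h : ¬Cofacial D a b) :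
    splitCocycle S D T F a b = Monoid.Coprod.inr (freeEdge S D T a b) :=
  if_neg h

lemma splitCocycle_self (a : V) : splitCocycle S D T F a a = 1 := by
  by_cases h : Cofacial D a a
  · rw [splitCocycle_of_cofacial h, edge_self, map_one]
  · rw [splitCocycle_of_not_cofacial h, freeEdge_self, map_one]

lemma splitCocycle_symm (a b : V) :
    splitCocycle S D T F b a = (splitCocycle S D T F a b)⁻¹ := by
  by_cases h : Cofacial D a b
  · rw [splitCocycle_of_cofacial h, splitCocycle_of_cofacial h.symm, edge_symm a b, map_inv]
  · rw [splitCocycle_of_not_cofacial h, splitCocycle_of_not_cofacial (mt Cofacial.symm h),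
      freeEdge_symm a b, map_inv]

lemma splitCocycle_of_adj (hTF : ∀ a b, Cofacial D a b → T.Adj a b → F.Adj a b)
    (h : T.Adj a b) : splitCocycle S D T F a b = 1 := by
  by_cases hab : Cofacial D a b
  · rw [splitCocycle_of_cofacial hab, edge_of_adj (hTF a b hab h), map_one]
  · rw [splitCocycle_of_not_cofacial hab, freeEdge_of_adj h, map_one]

lemma isCocycle_splitCocycle (hSD : ∀ s ∈ S, s ∉ D → s.card ≤ 2) :
    IsCocycle S (splitCocycle S D T F) := by
  intro s hs a ha b hb c hc
  by_cases hsD : s ∈ D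
  · rw [splitCocycle_of_cofacial ⟨s, hsD, ha, hb⟩, splitCocycle_of_cofacial ⟨s, hsD, hb, hc⟩,
      splitCocycle_of_cofacial ⟨s, hsD, ha, hc⟩, ← map_mul,
      isCocycle_edge s hsD a ha b hb c hc]
  · exact mul_eq_of_card_le_two splitCocycle_self splitCocycle_symm (hSD s hs hsD) ha hb hc

/-- Sends the edges of `D` to themselves and each free generator to its edge. -/
noncomputable def unsplit (hDS : D ⊆ S) (hFT : F ≤ T) :
    Monoid.Coprod (EdgeGroup D F) (FreeGroup (FreeEdge S D T)) →* EdgeGroup S T :=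
  Monoid.Coprod.lift
    (EdgeGroup.lift (edge S T) (isCocycle_edge.mono hDS) fun _ _ _ h => edge_of_adj (hFT h))
    (FreeGroup.lift fun p => edge S T p.1.1 p.1.2)

lemma unsplit_inl_edge (hDS : D ⊆ S) (hFT : F ≤ T) (h : Cofacial D a b) :
    unsplit hDS hFT (Monoid.Coprod.inl (edge D F a b)) = edge S T a b := by
  rw [unsplit, Monoid.Coprod.lift_apply_inl, EdgeGroup.lift_edge _ _ h]

lemma unsplit_inr_of (hDS : D ⊆ S) (hFT : F ≤ T) (p : FreeEdge S D T) :
    unsplit hDS hFT (Monoid.Coprod.inr (FreeGroup.of p)) = edge S T p.1.1 p.1.2 := by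
  rw [unsplit, Monoid.Coprod.lift_apply_inr, FreeGroup.lift_apply_of]

lemma unsplit_inr_freeEdge_of_lt (hDS : D ⊆ S) (hFT : F ≤ T) (hab : Cofacial S a b)
    (hD : ¬Cofacial D a b) (hlt : a < b) :
    unsplit hDS hFT (Monoid.Coprod.inr (freeEdge S D T a b)) = edge S T a b := by
  by_cases hT : T.Adj a b
  · rw [freeEdge_of_adj hT, map_one, map_one, edge_of_adj hT]
  · rw [freeEdge_of_isFreeEdge ⟨hlt, hab, hD, hT⟩, unsplit_inr_of]

lemma unsplit_inr_freeEdge (hDS : D ⊆ S) (hFT : F ≤ T) (hab : Cofacial S a b)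
    (hD : ¬Cofacial D a b) :
    unsplit hDS hFT (Monoid.Coprod.inr (freeEdge S D T a b)) = edge S T a b := by
  obtain h | rfl | h := lt_trichotomy a b
  · exact unsplit_inr_freeEdge_of_lt hDS hFT hab hD h
  · rw [freeEdge_self, map_one, map_one, edge_self]
  · rw [freeEdge_symm b a, edge_symm b a, map_inv, map_inv,
      unsplit_inr_freeEdge_of_lt hDS hFT hab.symm (mt Cofacial.symm hD) h]

lemma unsplit_splitCocycle (hDS : D ⊆ S) (hFT : F ≤ T) (hab : Cofacial S a b) :
    unsplit hDS hFT (splitCocycle S D T F a b) = edge S T a b := by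
  by_cases hD : Cofacial D a b
  · rw [splitCocycle_of_cofacial hD, unsplit_inl_edge hDS hFT hD]
  · rw [splitCocycle_of_not_cofacial hD, unsplit_inr_freeEdge hDS hFT hab hD]

/-- Adding edges to a family of simplices multiplies its edge group freely by a free group, on the
added edges outside the forest. -/
noncomputable def splitEquiv (hDS : D ⊆ S) (hSD : ∀ s ∈ S, s ∉ D → s.card ≤ 2) (hFT : F ≤ T)
    (hTF : ∀ a b, Cofacial D a b → T.Adj a b → F.Adj a b) :
    EdgeGroup S T ≃* Monoid.Coprod (EdgeGroup D F) (FreeGroup (FreeEdge S D T)) :=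
  MonoidHom.toMulEquiv
    (EdgeGroup.lift (splitCocycle S D T F) (isCocycle_splitCocycle hSD)
      fun _ _ _ h => splitCocycle_of_adj hTF h)
    (unsplit hDS hFT)
    (EdgeGroup.hom_ext fun a b h => by
      simp only [MonoidHom.comp_apply, MonoidHom.id_apply, EdgeGroup.lift_edge _ _ h,
        unsplit_splitCocycle hDS hFT h])
    (Monoid.Coprod.hom_ext
      (EdgeGroup.hom_ext fun a b h => by
        simp only [MonoidHom.comp_apply, MonoidHom.id_apply, unsplit_inl_edge hDS hFT h,
          EdgeGroup.lift_edge _ _ (h.mono hDS), splitCocycle_of_cofacial h])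
      (FreeGroup.ext_hom _ _ fun p => by
        simp only [MonoidHom.comp_apply, MonoidHom.id_apply, unsplit_inr_of,
          EdgeGroup.lift_edge _ _ p.2.2.1, splitCocycle_of_not_cofacial p.2.2.2.1,
          freeEdge_of_isFreeEdge p.2]))

end Splitting

section Relabel

variable {V W : Type*} {D : Set (Finset V)} {F : SimpleGraph W} {f : V ↪ W}

lemma cofacial_map_iff {x y : W} :
    Cofacial (Finset.map f '' D) x y ↔ ∃ a b, Cofacial D a b ∧ f a = x ∧ f b = y := by
  constructor
  · rintro ⟨_, ⟨s, hs, rfl⟩, hx, hy⟩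
    obtain ⟨a, ha, rfl⟩ := Finset.mem_map.1 hx
    obtain ⟨b, hb, rfl⟩ := Finset.mem_map.1 hy
    exact ⟨a, b, ⟨s, hs, ha, hb⟩, rfl, rfl⟩
  · rintro ⟨a, b, ⟨s, hs, ha, hb⟩, rfl, rfl⟩
    exact ⟨_, ⟨s, hs, rfl⟩, Finset.mem_map_of_mem f ha, Finset.mem_map_of_mem f hb⟩

lemma Cofacial.map {a b : V} (h : Cofacial D a b) : Cofacial (Finset.map f '' D) (f a) (f b) :=
  cofacial_map_iff.2 ⟨a, b, h, rfl, rfl⟩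

lemma isCocycle_edge_map :
    IsCocycle D fun a b => edge (Finset.map f '' D) F (f a) (f b) := fun _ hs _ ha _ hb _ hc =>
  isCocycle_edge _ (Set.mem_image_of_mem _ hs) _ (Finset.mem_map_of_mem f ha) _
    (Finset.mem_map_of_mem f hb) _ (Finset.mem_map_of_mem f hc)

lemma isCocycle_edge_invFun [Nonempty V] : IsCocycle (Finset.map f '' D) fun x y =>
    edge D (F.comap f) (Function.invFun f x) (Function.invFun f y) := by
  rintro _ ⟨s, hs, rfl⟩ x hx y hy z hz
  obtain ⟨a, ha, rfl⟩ := Finset.mem_map.1 hx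
  obtain ⟨b, hb, rfl⟩ := Finset.mem_map.1 hy
  obtain ⟨c, hc, rfl⟩ := Finset.mem_map.1 hz
  simp only [Function.leftInverse_invFun f.injective _, isCocycle_edge s hs a ha b hb c hc]

lemma edge_invFun_of_adj [Nonempty V] {x y : W} (h : Cofacial (Finset.map f '' D) x y)
    (hF : F.Adj x y) : edge D (F.comap f) (Function.invFun f x) (Function.invFun f y) = 1 := by
  obtain ⟨a, b, -, rfl, rfl⟩ := cofacial_map_iff.1 h
  simp only [Function.leftInverse_invFun f.injective _]
  exact edge_of_adj hF

/-- Renaming the vertices along an embedding does not change the edge group. -/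
noncomputable def relabelEquiv [Nonempty V] (D : Set (Finset V)) (F : SimpleGraph W) (f : V ↪ W) :
    EdgeGroup D (F.comap f) ≃* EdgeGroup (Finset.map f '' D) F :=
  MonoidHom.toMulEquiv
    (EdgeGroup.lift _ isCocycle_edge_map fun _ _ _ h => edge_of_adj h)
    (EdgeGroup.lift _ isCocycle_edge_invFun fun _ _ => edge_invFun_of_adj)
    (EdgeGroup.hom_ext fun a b h => by
      simp only [MonoidHom.comp_apply, MonoidHom.id_apply, EdgeGroup.lift_edge _ _ h,
        EdgeGroup.lift_edge _ _ h.map, Function.leftInverse_invFun f.injective _])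
    (EdgeGroup.hom_ext fun x y h => by
      obtain ⟨a, b, hab, rfl, rfl⟩ := cofacial_map_iff.1 h
      simp only [MonoidHom.comp_apply, MonoidHom.id_apply, EdgeGroup.lift_edge _ _ h,
        EdgeGroup.lift_edge _ _ hab, Function.leftInverse_invFun f.injective _])

end Relabel

section FreeIndex

/-- The free product with a trivial group. -/
noncomputable def coprodUnique (G H : Type*) [Group G] [Group H] [Unique H] :
    Monoid.Coprod G H ≃* G :=
  (MulEquiv.coprodCongr (.refl G) (.ofUnique : H ≃* PUnit.{1})).trans (.coprodPUnit G)

lemma HasFreeIndex.isEmpty_of_mulEquiv {G E R : Type} [Group G] [Group E] [Finite R]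
    (hG : HasFreeIndex G 0) (e : G ≃* Monoid.Coprod E (FreeGroup R)) : IsEmpty R := by
  by_contra hR
  rw [not_isEmpty_iff] at hR
  obtain ⟨H, _, ⟨e₁⟩, hH⟩ := hG
  obtain ⟨n, ⟨e₂⟩⟩ := Finite.exists_equiv_fin R
  have hn : 0 < n := Fin.pos (e₂ (Classical.arbitrary R))
  exact (hH E n hn).false ((coprodUnique H _).symm.trans (e₁.symm.trans (e.trans
    (.coprodCongr (.refl E) (FreeGroup.freeGroupCongr e₂)))))

lemma HasNoFreeFactor.hasFreeIndex_zero {G : Type} [Group G] (hG : HasNoFreeFactor G) :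
    HasFreeIndex G 0 :=
  ⟨G, _, ⟨(coprodUnique G _).symm⟩, hG⟩

end FreeIndex

section Forests

variable {V W : Type*}

lemma reachable_comap {f : V ↪ W} {F : SimpleGraph W} (hF : ∀ x y, F.Adj x y → y ∈ Set.range f)
    {a b : V} (h : F.Reachable (f a) (f b)) : (F.comap f).Reachable a b := by
  obtain ⟨p⟩ := h
  generalize hx : f a = x, hy : f b = y at p
  induction p generalizing a with
  | nil => exact f.injective (hx.trans hy.symm) ▸ .rfl
  | cons h p ih =>
    subst hx
    obtain ⟨c, rfl⟩ := hF _ _ h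
    have hac : (F.comap f).Adj a c := h
    exact hac.reachable.trans (ih rfl hy)

lemma adj_of_reachable_of_isAcyclic {F T : SimpleGraph V} (hT : T.IsAcyclic) (hF : F ≤ T) {a b : V}
    (h : T.Adj a b) (hr : F.Reachable a b) : F.Adj a b := by
  by_contra hn
  have hbridge := SimpleGraph.isAcyclic_iff_forall_adj_isBridge.1 hT h
  rw [SimpleGraph.isBridge_iff] at hbridge
  refine hbridge (hr.mono fun x y hxy => ?_)
  rw [SimpleGraph.deleteEdges_adj]
  refine ⟨hF hxy, fun he => hn ?_⟩
  rwa [← F.mem_edgeSet, ← Set.mem_singleton_iff.1 he]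

/-- A chosen spanning forest of the `1`-skeleton. -/
noncomputable def forest (D : Set (Finset V)) : SimpleGraph V :=
  (skeletonGraph D).exists_isAcyclic_reachable_eq_le.choose

lemma forest_le (D : Set (Finset V)) : forest D ≤ skeletonGraph D :=
  (skeletonGraph D).exists_isAcyclic_reachable_eq_le.choose_spec.1

lemma isAcyclic_forest (D : Set (Finset V)) : (forest D).IsAcyclic :=
  (skeletonGraph D).exists_isAcyclic_reachable_eq_le.choose_spec.2.1

lemma reachable_forest (D : Set (Finset V)) :
    (forest D).Reachable = (skeletonGraph D).Reachable :=
  (skeletonGraph D).exists_isAcyclic_reachable_eq_le.choose_spec.2.2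

lemma comap_forest_le (D : Set (Finset V)) (f : V ↪ W) :
    (forest (Finset.map f '' D)).comap f ≤ skeletonGraph D := by
  intro a b h
  obtain ⟨hne, hab⟩ := forest_le _ h
  obtain ⟨a', b', hab', ha, hb⟩ := cofacial_map_iff.1 hab
  rw [f.injective ha, f.injective hb] at hab'
  exact ⟨fun h => hne (congrArg f h), hab'⟩

lemma reachable_comap_forest {D : Set (Finset V)} {f : V ↪ W} {a b : V} (h : Cofacial D a b) :
    ((forest (Finset.map f '' D)).comap f).Reachable a b := by
  refine reachable_comap (fun x y hxy => ?_) (reachable_forest (Finset.map f '' D) ▸ ?_)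
  · obtain ⟨_, b, -, -, hb⟩ := cofacial_map_iff.1 (forest_le _ hxy).2
    exact ⟨b, hb⟩
  · exact h.map.reachable

end Forests

section Triangles

variable {ι : Type} [Fintype ι] {K : AbstractSimplicialComplex ι}

/-- The `2`-simplices of a family of simplices. -/
def triangles {V : Type*} (S : Set (Finset V)) : Set (Finset V) :=
  {s ∈ S | s.card = 3}

lemma IsTwoComplexFor.nonempty_edgeGroup_mulEquiv {G : Type*} [Group G] (h : IsTwoComplexFor K G)
    {T : SimpleGraph ι} (hTK : T ≤ skeletonGraph K.faces) (hT : T.IsTree) :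
    Nonempty (G ≃* EdgeGroup K.faces T) := by
  obtain ⟨-, _, x, ⟨e⟩⟩ := h
  obtain ⟨v, -⟩ := exists_pos x
  obtain ⟨w⟩ := nonempty_rootedWalks hT v
  exact ⟨e.symm.trans ((FundamentalGroup.fundamentalGroupMulEquivOfPathConnected x _).trans
    (edgeGroupEquiv hTK w).symm)⟩

/-- The spanning forest of the triangles extends to a spanning tree of the complex, so the edges
outside the triangles contribute a free factor. -/
lemma IsTwoComplexFor.exists_mulEquiv_coprod {G : Type*} [Group G] (h : IsTwoComplexFor K G)
    (f : ι ↪ ℕ) : ∃ (R : Type) (_ : Finite R), Nonempty (G ≃* Monoid.Coprod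
      (EdgeGroup (triangles K.faces) ((forest (Finset.map f '' triangles K.faces)).comap f))
      (FreeGroup R)) := by
  let _ : LinearOrder ι := LinearOrder.lift' f f.injective
  have _ : PathConnectedSpace (realization K) := h.2.1
  have hDS : triangles K.faces ⊆ K.faces := fun s hs => hs.1
  obtain ⟨T, hFT, hTK, hT⟩ :=
    connected_skeletonGraph.exists_isTree_le_of_le_of_isAcyclic
      ((comap_forest_le _ f).trans fun a b hab => ⟨hab.1, hab.2.mono hDS⟩)
      ((isAcyclic_forest _).of_comap f)
  obtain ⟨e⟩ := h.nonempty_edgeGroup_mulEquiv hTK hT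
  have hcard : ∀ s ∈ K.faces, s ∉ triangles K.faces → s.card ≤ 2 := fun s hs hsD =>
    Nat.le_of_lt_succ ((h.1 s hs).lt_of_ne fun h3 => hsD ⟨hs, h3⟩)
  exact ⟨_, inferInstanceAs (Finite (Subtype _)), ⟨e.trans (splitEquiv hDS hcard hFT
    fun a b hab hadj => adj_of_reachable_of_isAcyclic hT.isAcyclic hFT hadj
      (reachable_comap_forest hab))⟩⟩

lemma IsTwoComplexFor.nonempty_mulEquiv {G : Type} [Group G] (h : IsTwoComplexFor K G)
    (hG : HasFreeIndex G 0) (f : ι ↪ ℕ) :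
    Nonempty (G ≃* EdgeGroup (Finset.map f '' triangles K.faces)
      (forest (Finset.map f '' triangles K.faces))) := by
  obtain ⟨R, _, ⟨e⟩⟩ := h.exists_mulEquiv_coprod f
  have _ : IsEmpty R := hG.isEmpty_of_mulEquiv e
  obtain ⟨-, -, x, -⟩ := h
  have _ : Nonempty ι := (exists_pos x).nonempty
  exact ⟨e.trans ((coprodUnique _ _).trans (relabelEquiv _ _ f))⟩

end Triangles

section Counting

lemma IsTwoComplexFor.kappa_le {ι : Type} [Fintype ι] {K : AbstractSimplicialComplex ι}
    {G : Type*} [Group G] (h : IsTwoComplexFor K G) : kappa G ≤ numSimplices K 2 :=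
  sInf_le ⟨ι, _, K, h, rfl⟩

lemma exists_complex_of_kappa_le {G : Type*} [Group G] {T : ℕ} (h : kappa G ≤ T) :
    ∃ (ι : Type) (_ : Fintype ι) (K : AbstractSimplicialComplex ι),
      IsTwoComplexFor K G ∧ numSimplices K 2 ≤ T := by
  obtain ⟨_, ⟨ι, _, K, hK, rfl⟩, hlt⟩ :=
    sInf_lt_iff.1 (h.trans_lt (Nat.cast_lt.2 T.lt_succ_self))
  exact ⟨ι, _, K, hK, Nat.le_of_lt_succ (Nat.cast_lt.1 hlt)⟩

lemma exists_embedding_lt {α : Type*} [Finite α] (W : Finset α) :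
    ∃ f : α ↪ ℕ, ∀ a ∈ W, f a < W.card := by
  classical
  have := Fintype.ofFinite α
  let e : W ⊕ {a // a ∉ W} ≃ Fin W.card ⊕ Fin (Fintype.card {a // a ∉ W}) :=
    .sumCongr W.equivFin (Fintype.equivFin _)
  refine ⟨((Equiv.sumCompl (· ∈ W)).symm.trans (e.trans finSumFinEquiv)).toEmbedding.trans
    Fin.valEmbedding, fun a ha => ?_⟩
  simp [e, Equiv.sumCompl_symm_apply_of_pos ha]

lemma card_powerset_filter_card_le {α : Type*} (A : Finset α) (n : ℕ) :
    {D ∈ A.powerset | D.card ≤ n}.card ≤ (A.card + 1) ^ n := by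
  classical
  have hsub : {D ∈ A.powerset | D.card ≤ n} ⊆
      (Finset.range (n + 1)).biUnion fun k => A.powersetCard k := fun D hD => by
    rw [Finset.mem_filter, Finset.mem_powerset] at hD
    exact Finset.mem_biUnion.2 ⟨D.card, Finset.mem_range_succ_iff.2 hD.2,
      Finset.mem_powersetCard.2 ⟨hD.1, rfl⟩⟩
  calc {D ∈ A.powerset | D.card ≤ n}.card
      ≤ ∑ k ∈ Finset.range (n + 1), (A.powersetCard k).card :=
        (Finset.card_le_card hsub).trans Finset.card_biUnion_le
    _ ≤ ∑ k ∈ Finset.range (n + 1), A.card ^ k * 1 ^ (n - k) * n.choose k := by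
        refine Finset.sum_le_sum fun k hk => ?_
        rw [Finset.card_powersetCard, one_pow, mul_one]
        exact (Nat.choose_le_pow _ _).trans (Nat.le_mul_of_pos_right _
          (Nat.choose_pos (Finset.mem_range_succ_iff.1 hk)))
    _ = (A.card + 1) ^ n := (add_pow _ _ _).symm

lemma choose_three_mul_add_one_le {T : ℕ} (hT : 2 ≤ T) : (3 * T).choose 3 + 1 ≤ T ^ 6 := by
  have hchoose : (3 * T).choose 3 * 6 ≤ (3 * T) ^ 3 := by
    rw [mul_comm, show 6 = Nat.factorial 3 from rfl, ← Nat.descFactorial_eq_factorial_mul_choose]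
    exact Nat.descFactorial_le_pow (3 * T) 3
  have hcube : 2 ^ 3 ≤ T ^ 3 := Nat.pow_le_pow_left hT 3
  rw [mul_pow] at hchoose
  rw [show T ^ 6 = T ^ 3 * T ^ 3 by ring]
  nlinarith

lemma groupClass_eq {G H : Type} [Group G] [Group H] (e : G ≃* H) :
    groupClass G = groupClass H :=
  Quotient.sound ⟨e.toGrpIso⟩

/-- The isomorphism class of the edge group of a finite family of sets of natural numbers. -/
noncomputable def edgeGroupClass (D : Finset (Finset ℕ)) : GroupClass :=
  groupClass (EdgeGroup (D : Set (Finset ℕ)) (forest D))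

/-- The families of at most `T` triangles with vertices below `3 * T`. -/
def triangleFamilies (T : ℕ) : Finset (Finset (Finset ℕ)) :=
  {D ∈ ((Finset.range (3 * T)).powersetCard 3).powerset | D.card ≤ T}

lemma exists_mem_triangleFamilies {ι : Type} [Fintype ι] {K : AbstractSimplicialComplex ι} {T : ℕ}
    (h : numSimplices K 2 ≤ T) : ∃ (f : ι ↪ ℕ), ∃ D ∈ triangleFamilies T,
      (D : Set (Finset ℕ)) = Finset.map f '' triangles K.faces := by
  classical
  obtain ⟨D, hD⟩ := (Set.toFinite (triangles K.faces)).exists_finset_coe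
  have hcard : D.card ≤ T := by rwa [← Set.ncard_coe_finset, hD]
  have hthree : ∀ s ∈ D, s.card = 3 := fun s hs =>
    (show s ∈ triangles K.faces from hD ▸ hs).2
  obtain ⟨f, hf⟩ := exists_embedding_lt (D.biUnion id)
  have hlt : ∀ s ∈ D, ∀ a ∈ s, f a < 3 * T := fun s hs a ha => calc
    f a < (D.biUnion id).card := hf a (Finset.mem_biUnion.2 ⟨s, hs, ha⟩)
    _ ≤ D.card * 3 := Finset.card_biUnion_le_card_mul _ _ _ fun s hs => (hthree s hs).le
    _ ≤ 3 * T := by lia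
  refine ⟨f, D.image (Finset.map f), Finset.mem_filter.2 ⟨?_, Finset.card_image_le.trans hcard⟩,
    by rw [Finset.coe_image, hD]⟩
  refine Finset.mem_powerset.2 (Finset.image_subset_iff.2 fun s hs => ?_)
  refine Finset.mem_powersetCard.2 ⟨fun x hx => ?_, (Finset.card_map f).trans (hthree s hs)⟩
  obtain ⟨a, ha, rfl⟩ := Finset.mem_map.1 hx
  exact Finset.mem_range.2 (hlt s hs a ha)

lemma groupsUpTo_subset (T : ℕ) :
    groupsUpTo T ⊆ edgeGroupClass '' (triangleFamilies T : Set (Finset (Finset ℕ))) := by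
  rintro _ ⟨G, _, rfl, hG, hT⟩
  obtain ⟨ι, _, K, hK, hn⟩ := exists_complex_of_kappa_le hT
  obtain ⟨f, D, hD, hDK⟩ := exists_mem_triangleFamilies hn
  obtain ⟨e⟩ := hK.nonempty_mulEquiv hG f
  rw [← hDK] at e
  exact ⟨D, hD, (groupClass_eq e).symm⟩

lemma groupsUpTo_finite (T : ℕ) : (groupsUpTo T).Finite :=
  ((Finset.finite_toSet _).image _).subset (groupsUpTo_subset T)

lemma ncard_groupsUpTo_le {T : ℕ} (hT : 2 ≤ T) : (groupsUpTo T).ncard ≤ T ^ (6 * T) :=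
  calc (groupsUpTo T).ncard
      ≤ (triangleFamilies T : Set (Finset (Finset ℕ))).ncard :=
        (Set.ncard_le_ncard (groupsUpTo_subset T) ((Finset.finite_toSet _).image _)).trans
          (Set.ncard_image_le (Finset.finite_toSet _))
    _ ≤ ((3 * T).choose 3 + 1) ^ T := by
        rw [Set.ncard_coe_finset]
        exact (card_powerset_filter_card_le _ _).trans_eq (by
          rw [Finset.card_powersetCard, Finset.card_range])
    _ ≤ T ^ (6 * T) := pow_mul T 6 T ▸ Nat.pow_le_pow_left (choose_three_mul_add_one_le hT) T

lemma ncard_groupsUpTo_le_rpow {T : ℕ} (hT : 2 ≤ T) :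
    ((groupsUpTo T).ncard : ℝ) ≤ (2 : ℝ) ^ (6 * (T : ℝ) * Real.logb 2 (T : ℝ)) := by
  have hT₀ : (0 : ℝ) < T := by positivity
  rw [mul_comm, Real.rpow_mul two_pos.le, Real.rpow_logb two_pos (by norm_num) hT₀]
  exact_mod_cast ncard_groupsUpTo_le hT

end Counting

section CyclicEdgeGroup

variable {V : Type*} {S : Set (Finset V)} {T : SimpleGraph V} {m : ℕ} {ℓ : V → V → ℤ} {a b : V}

/-- The homomorphism from `ℤ / m` which sends `1` to an element killed by `m`. -/
def zmodPowersHom {G : Type*} [Group G] (g : G) (hg : g ^ m = 1) :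
    Multiplicative (ZMod m) →* G :=
  AddMonoidHom.toMultiplicativeLeft (ZMod.lift m ⟨zmultiplesHom (Additive G) (.ofMul g), by
    rw [zmultiplesHom_apply, natCast_zsmul, ← ofMul_pow, hg, ofMul_one]⟩)

lemma zmodPowersHom_ofAdd_intCast {G : Type*} [Group G] {g : G} (hg : g ^ m = 1) (j : ℤ) :
    zmodPowersHom g hg (.ofAdd (j : ZMod m)) = g ^ j := by
  simp [zmodPowersHom]

/-- An edge group is cyclic of order `m` if an integral labelling of the edges, which is a cocycle
modulo `m`, expresses every edge as a power of an edge with label `1`. -/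
noncomputable def edgeGroupEquivZMod
    (hℓ : IsCocycle S fun u v => Multiplicative.ofAdd (ℓ u v : ZMod m))
    (hT : ∀ u v, T.Adj u v → ℓ u v = 0) (hab : Cofacial S a b) (hab₁ : ℓ a b = 1)
    (hpow : ∀ u v, Cofacial S u v → edge S T u v = edge S T a b ^ ℓ u v)
    (hm : edge S T a b ^ m = 1) : EdgeGroup S T ≃* Multiplicative (ZMod m) :=
  have hT' : ∀ u v, Cofacial S u v → T.Adj u v → Multiplicative.ofAdd (ℓ u v : ZMod m) = 1 :=
    fun u v _ h => by rw [hT u v h, Int.cast_zero, ofAdd_zero]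
  MonoidHom.toMulEquiv (EdgeGroup.lift _ hℓ hT') (zmodPowersHom _ hm)
    (EdgeGroup.hom_ext fun u v h => by
      rw [MonoidHom.comp_apply, EdgeGroup.lift_edge hℓ hT' h, zmodPowersHom_ofAdd_intCast,
        MonoidHom.id_apply, hpow u v h])
    (MonoidHom.ext fun c => by
      obtain ⟨j, hj⟩ := ZMod.intCast_surjective c.toAdd
      obtain rfl : c = .ofAdd (j : ZMod m) := hj ▸ (ofAdd_toAdd c).symm
      rw [MonoidHom.comp_apply, zmodPowersHom_ofAdd_intCast, map_zpow,
        EdgeGroup.lift_edge hℓ hT' hab, hab₁, ← ofAdd_zsmul, Int.cast_one, zsmul_one,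
        MonoidHom.id_apply])

end CyclicEdgeGroup

section TripleComplex

variable {V : Type*} [DecidableEq V] {u v w : V}

/-- The set of vertices of a triple. -/
def simplex (t : V × V × V) : Finset V := {t.1, t.2.1, t.2.2}

lemma mem_simplex {t : V × V × V} : u ∈ simplex t ↔ u = t.1 ∨ u = t.2.1 ∨ u = t.2.2 := by
  simp only [simplex, Finset.mem_insert, Finset.mem_singleton]

/-- The simplicial complex of all subsets of the triples in `Δ`. Triples may have repeated
entries, so `Δ` can also contain edges. -/
def tripleComplex (Δ : Set (V × V × V)) (hΔ : ∀ v, ∃ t ∈ Δ, v ∈ simplex t) :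
    AbstractSimplicialComplex V where
  faces := {s | s.Nonempty ∧ ∃ t ∈ Δ, s ⊆ simplex t}
  isRelLowerSet_faces := fun _ ⟨hs, t, ht, hst⟩ =>
    ⟨hs, fun _ hs' hne => ⟨hne, t, ht, hs'.trans hst⟩⟩
  singleton_mem v := ⟨Finset.singleton_nonempty v, by simpa using hΔ v⟩

variable {Δ : Set (V × V × V)} {hΔ : ∀ v, ∃ t ∈ Δ, v ∈ simplex t}

lemma cofacial_tripleComplex_iff :
    Cofacial (tripleComplex Δ hΔ).faces u v ↔ ∃ t ∈ Δ, u ∈ simplex t ∧ v ∈ simplex t := by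
  constructor
  · rintro ⟨s, ⟨-, t, ht, hst⟩, hu, hv⟩
    exact ⟨t, ht, hst hu, hst hv⟩
  · rintro ⟨t, ht, hu, hv⟩
    exact ⟨simplex t, ⟨⟨u, hu⟩, t, ht, subset_rfl⟩, hu, hv⟩

lemma IsCocycle.mul_of_mem {G : Type*} [Mul G] {f : V → V → G}
    (hf : IsCocycle (tripleComplex Δ hΔ).faces f) (h : (u, v, w) ∈ Δ) : f u v * f v w = f u w :=
  hf (simplex (u, v, w)) ⟨⟨u, by simp [simplex]⟩, _, h, subset_rfl⟩ u (by simp [simplex]) v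
    (by simp [simplex]) w (by simp [simplex])

lemma isCocycle_tripleComplex {G : Type*} [Group G] {f : V → V → G} (hself : ∀ u, f u u = 1)
    (hsymm : ∀ u v, f v u = (f u v)⁻¹)
    (hmul : ∀ t ∈ Δ, f t.1 t.2.1 * f t.2.1 t.2.2 = f t.1 t.2.2) :
    IsCocycle (tripleComplex Δ hΔ).faces f := by
  rintro s ⟨-, t, ht, hst⟩ u hu v hv w hw
  obtain rfl | rfl | rfl := mem_simplex.1 (hst hu) <;>
  obtain rfl | rfl | rfl := mem_simplex.1 (hst hv) <;>
  obtain rfl | rfl | rfl := mem_simplex.1 (hst hw) <;>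
  simp only [hself, hsymm t.1 t.2.1, hsymm t.2.1 t.2.2, hsymm t.1 t.2.2, ← hmul t ht] <;> group

lemma card_le_three_of_mem_tripleComplex {s : Finset V} (hs : s ∈ (tripleComplex Δ hΔ).faces) :
    s.card ≤ 3 :=
  let ⟨_, _, _, hst⟩ := hs
  (Finset.card_le_card hst).trans Finset.card_le_three

lemma numSimplices_tripleComplex_le {ι : Type} [Fintype ι] [DecidableEq ι] {Δ : Set (ι × ι × ι)}
    {hΔ : ∀ v, ∃ t ∈ Δ, v ∈ simplex t} (L : List (ι × ι × ι))
    (hL : ∀ t ∈ Δ, (simplex t).card = 3 → t ∈ L) :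
    numSimplices (tripleComplex Δ hΔ) 2 ≤ L.countP fun t => (simplex t).card = 3 := by
  have hsub : {s | s ∈ (tripleComplex Δ hΔ).faces ∧ s.card = 2 + 1} ⊆
      (((L.filter fun t => (simplex t).card = 3).map simplex).toFinset : Set (Finset ι)) := by
    rintro s ⟨⟨-, t, ht, hst⟩, hs⟩
    obtain rfl : s = simplex t :=
      Finset.eq_of_subset_of_card_le hst (Finset.card_le_three.trans hs.ge)
    simp only [List.coe_toFinset, List.mem_map, List.mem_filter, decide_eq_true_eq]
    exact ⟨t, ⟨hL t ht hs, hs⟩, rfl⟩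
  calc numSimplices (tripleComplex Δ hΔ) 2
      ≤ ((L.filter fun t => (simplex t).card = 3).map simplex).toFinset.card :=
        (Set.ncard_le_ncard hsub (Finset.finite_toSet _)).trans_eq (Set.ncard_coe_finset _)
    _ ≤ L.countP fun t => (simplex t).card = 3 :=
        (List.toFinset_card_le _).trans_eq (by rw [List.length_map, List.countP_eq_length_filter])

end TripleComplex

section Telescope

/-- The vertices of the telescope with `k` stages: the root `p`, the ends `a` and `b` of the edge
which carries the generator, the ends `x i` and `y i` of the edge which carries its multiple
`horner ε i`, the cone point `c` of the annulus between the edges `a b` and `x 0 y 0`, and the cone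
point `z i` of the `i`-th stage. -/
inductive Vtx (k : ℕ) : Type
  | p | a | b | c
  | x (i : Fin (k + 1)) | y (i : Fin (k + 1))
  | z (i : Fin k)
  deriving DecidableEq, Fintype

open Vtx

/-- The numbers with binary digits `1, ε 0, ε 1, …`, leading digit first. -/
def horner (ε : ℕ → Bool) : ℕ → ℕ
  | 0 => 1
  | i + 1 => 2 * horner ε i + (ε i).toNat

variable (ε : ℕ → Bool) {k : ℕ}

/-- The source of the edge which contributes the digit `ε i`: this edge is `a b` if the digit is
`1`, and it is degenerate otherwise. -/
def digitSrc (i : Fin k) : Vtx k := if ε i then a else p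

/-- The target of the edge which contributes the digit `ε i`. -/
def digitTgt (i : Fin k) : Vtx k := if ε i then b else p

variable (k) in
/-- The triangles which make the loops through the edges `a b` and `x 0 y 0` homotopic. -/
def bottomTriples : List (Vtx k × Vtx k × Vtx k) :=
  [(p, a, x 0), (p, b, y 0), (c, a, x 0), (c, b, a), (c, y 0, b), (c, x 0, y 0)]

/-- The triples of a stage which do not depend on the digit. -/
def doublingTriples (i : Fin k) : List (Vtx k × Vtx k × Vtx k) :=
  [(p, y i.castSucc, y i.succ), (p, x i.succ, x i.castSucc),
    (x i.succ, x i.castSucc, y i.castSucc), (x i.castSucc, y i.castSucc, y i.succ),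
    (z i, x i.succ, y i.castSucc), (z i, x i.castSucc, y i.succ), (z i, x i.succ, y i.succ)]

/-- The triples of a stage which attach the edge contributing the digit. Those of them which
are degenerate, because the digit vanishes, are edges. -/
def digitTriples (i : Fin k) : List (Vtx k × Vtx k × Vtx k) :=
  [(p, y i.castSucc, digitSrc ε i), (p, digitTgt ε i, x i.castSucc),
    (z i, y i.castSucc, digitSrc ε i), (z i, digitSrc ε i, digitTgt ε i),
    (z i, digitTgt ε i, x i.castSucc)]

/-- The triples of a stage. Their union makes the loop through the edge from `x (i + 1)` to
`y (i + 1)` homotopic to the square of the loop through the edge from `x i` to `y i`, times the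
loop through the edge which contributes the digit.

The loop to be coned off would run twice through the edge from `x i` to `y i`, so its cone would
not be a simplicial complex. Replacing the first passage by the edge from `x (i + 1)` to `y i` and
the second one by the edge from `x i` to `y (i + 1)` makes the boundary of the cone embedded. -/
def stageTriples (i : Fin k) : List (Vtx k × Vtx k × Vtx k) :=
  doublingTriples i ++ digitTriples ε i

variable (k) in
/-- The triples of the telescope except for the one that closes its top. -/
def openTriples : List (Vtx k × Vtx k × Vtx k) :=
  bottomTriples k ++ (List.finRange k).flatMap (stageTriples ε)

variable (k) in
/-- The triples of the telescope. -/
def allTriples : List (Vtx k × Vtx k × Vtx k) :=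
  (p, x (Fin.last k), y (Fin.last k)) :: openTriples ε k

/-- The parent of a vertex in the spanning tree rooted at `p`. -/
def parent : Vtx k → Vtx k
  | c => a
  | z i => x i.succ
  | _ => p

/-- The spanning tree of the telescope. -/
def tree (k : ℕ) : SimpleGraph (Vtx k) := SimpleGraph.fromRel fun u v => v = parent u

lemma tree_adj_parent {v : Vtx k} (h : parent v ≠ v) : (tree k).Adj (parent v) v := by
  simp [tree, h]

/-- The path in the spanning tree from the root to a vertex. -/
def treeWalk : ∀ v : Vtx k, (tree k).Walk p v
  | p => .nil
  | a => .cons (tree_adj_parent (v := a) nofun) .nil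
  | b => .cons (tree_adj_parent (v := b) nofun) .nil
  | x i => .cons (tree_adj_parent (v := x i) nofun) .nil
  | y i => .cons (tree_adj_parent (v := y i) nofun) .nil
  | c => .cons (tree_adj_parent (v := a) nofun) (.cons (tree_adj_parent (v := c) nofun) .nil)
  | z i => .cons (tree_adj_parent (v := x i.succ) nofun)
      (.cons (tree_adj_parent (v := z i) nofun) .nil)

lemma treeWalk_eq_concat : ∀ (v : Vtx k) (h : (tree k).Adj (parent v) v),
    treeWalk v = (treeWalk (parent v)).concat h
  | p, h => absurd rfl h.ne
  | a, _ | b, _ | c, _ | x _, _ | y _, _ | z _, _ => rfl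

/-- The label of an edge in the direction in which it occurs in the triples. -/
def halfLabel : Vtx k → Vtx k → ℤ
  | a, b => 1
  | x i, y j => horner ε (min i j : Fin (k + 1))
  | c, b => 1
  | c, y _ => 1
  | z i, p => horner ε i
  | z i, a => horner ε i
  | z i, b => horner ε i + 1
  | z i, x j => horner ε (i + 1) - horner ε j
  | z _, y j => horner ε j
  | _, _ => 0

/-- The multiple of the generator represented by the loop through the edge from `u` to `v` which
otherwise stays in the spanning tree. -/
def label (u v : Vtx k) : ℤ := halfLabel ε u v - halfLabel ε v u

lemma label_self (u : Vtx k) : label ε u u = 0 := sub_self _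

lemma label_symm (u v : Vtx k) : label ε v u = -label ε u v := (neg_sub _ _).symm

lemma label_parent (v : Vtx k) : label ε v (parent v) = 0 := by
  cases v <;> simp [label, parent, halfLabel]

lemma label_of_tree_adj {u v : Vtx k} (h : (tree k).Adj u v) : label ε u v = 0 := by
  obtain rfl | rfl := h.2
  · exact label_parent ε u
  · rw [label_symm, label_parent, neg_zero]

lemma label_of_mem_stageTriples (i : Fin k) : ∀ t ∈ stageTriples ε i,
    label ε t.1 t.2.1 + label ε t.2.1 t.2.2 = label ε t.1 t.2.2 := by
  cases h : ε i <;>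
    simp [stageTriples, doublingTriples, digitTriples, digitSrc, digitTgt, label, halfLabel,
      horner, h] <;> ring_nf

lemma label_of_mem_openTriples : ∀ t ∈ openTriples ε k,
    label ε t.1 t.2.1 + label ε t.2.1 t.2.2 = label ε t.1 t.2.2 := by
  intro t ht
  rw [openTriples, List.mem_append, List.mem_flatMap] at ht
  obtain ht | ⟨i, -, ht⟩ := ht
  · revert t
    simp [bottomTriples, label, halfLabel, horner]
  · exact label_of_mem_stageTriples ε i t ht

/-- The generating triples of the telescope: its triples and the edges of its spanning tree. -/
def generators (ε : ℕ → Bool) (k : ℕ) : Set (Vtx k × Vtx k × Vtx k) :=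
  {t | t ∈ allTriples ε k ∨ ∃ v, t = (v, parent v, parent v)}

/-- The telescope, a complex whose edge group is cyclic of order `horner ε k`. -/
def telescope (ε : ℕ → Bool) (k : ℕ) : AbstractSimplicialComplex (Vtx k) :=
  tripleComplex (generators ε k) fun v => ⟨_, Or.inr ⟨v, rfl⟩, by simp [simplex]⟩

lemma countP_stageTriples_le (i : Fin k) :
    ((stageTriples ε i).countP fun t => (simplex t).card = 3) ≤ if ε i then 12 else 9 := by
  have hdigit : ((digitTriples ε i).countP fun t => (simplex t).card = 3) ≤
      if ε i then 5 else 2 := by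
    cases h : ε i
    · simp [digitTriples, digitSrc, digitTgt, h, simplex]
    · exact List.countP_le_length
  rw [stageTriples, List.countP_append]
  calc _ ≤ 7 + (if ε i then 5 else 2) := add_le_add List.countP_le_length hdigit
    _ = if ε i then 12 else 9 := by split_ifs <;> rfl

/-- An upper bound for the number of triangles of the telescope. A triple of a stage which is
degenerate because the digit vanishes is not counted. -/
def triangleBound (ε : ℕ → Bool) (k : ℕ) : ℕ :=
  7 + ∑ i ∈ Finset.range k, if ε i then 12 else 9

lemma countP_allTriples_le :
    ((allTriples ε k).countP fun t => (simplex t).card = 3) ≤ triangleBound ε k := by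
  have hstages : (((List.finRange k).flatMap (stageTriples ε)).countP
      fun t => (simplex t).card = 3) ≤ ∑ i ∈ Finset.range k, if ε i then 12 else 9 := by
    rw [List.countP_flatMap, Finset.sum_range fun i => if ε i then 12 else 9, Fin.sum_univ_def]
    exact List.sum_le_sum fun i _ => countP_stageTriples_le ε i
  rw [allTriples, openTriples, ← List.cons_append, List.countP_append]
  exact add_le_add List.countP_le_length hstages

lemma numSimplices_telescope_le : numSimplices (telescope ε k) 2 ≤ triangleBound ε k := by
  refine (numSimplices_tripleComplex_le (allTriples ε k) fun t ht hcard => ?_).trans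
    (countP_allTriples_le ε)
  obtain ht | ⟨v, rfl⟩ := ht
  · exact ht
  · have hle : (simplex (v, parent v, parent v)).card ≤ 2 := by
      simpa [simplex] using Finset.card_le_two
    omega

lemma tree_le_skeletonGraph : tree k ≤ skeletonGraph (telescope ε k).faces := by
  have hparent (v : Vtx k) : Cofacial (telescope ε k).faces v (parent v) :=
    cofacial_tripleComplex_iff.2 ⟨_, Or.inr ⟨v, rfl⟩, by simp [simplex], by simp [simplex]⟩
  rintro u v ⟨hne, rfl | rfl⟩
  · exact ⟨hne, hparent u⟩
  · exact ⟨hne, (hparent v).symm⟩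

/-- The walks in the spanning tree of the telescope from the root to the vertices. -/
def treeWalks (k : ℕ) : RootedWalks (tree k) p where
  walk := treeWalk
  concat h := by
    obtain rfl | rfl := h.2
    · exact Or.inr (treeWalk_eq_concat _ _)
    · exact Or.inl (treeWalk_eq_concat _ _)

lemma pathConnectedSpace_telescope : PathConnectedSpace (realization (telescope ε k)) :=
  pathConnectedSpace_of_connected_skeletonGraph <|
    ((tree k).connected_iff_exists_forall_reachable.2 ⟨p, fun v => (treeWalk v).reachable⟩).mono
      (tree_le_skeletonGraph ε)

lemma isCocycle_label : IsCocycle (telescope ε k).faces fun u v =>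
    Multiplicative.ofAdd (label ε u v : ZMod (horner ε k)) := by
  refine isCocycle_tripleComplex (fun u => ?_) (fun u v => ?_) fun t ht => ?_
  · rw [label_self, Int.cast_zero, ofAdd_zero]
  · rw [label_symm, Int.cast_neg, ofAdd_neg]
  rw [← ofAdd_add]
  congr 1
  obtain ht | ⟨v, rfl⟩ := ht
  · obtain rfl | ht := List.mem_cons.1 ht
    · simp [label, halfLabel]
    · rw [← Int.cast_add, label_of_mem_openTriples ε t ht]
  · rw [label_self, Int.cast_zero, add_zero]

/-- The edge from `u` to `v` represents the power of the generator given by its label. -/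
def IsLabelled (u v : Vtx k) : Prop :=
  edge (telescope ε k).faces (tree k) u v = edge (telescope ε k).faces (tree k) a b ^ label ε u v

variable {ε}

lemma IsLabelled.symm {u v : Vtx k} (h : IsLabelled ε u v) : IsLabelled ε v u := by
  rw [IsLabelled, edge_symm u v, label_symm, zpow_neg, h]

lemma isLabelled_self (u : Vtx k) : IsLabelled ε u u := by
  rw [IsLabelled, edge_self, label_self, zpow_zero]

lemma isLabelled_parent (v : Vtx k) : IsLabelled ε v (parent v) := by
  by_cases h : parent v = v
  · rw [h]
    exact isLabelled_self v
  · rw [IsLabelled, label_parent, zpow_zero]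
    exact edge_of_adj (tree_adj_parent h).symm

lemma isLabelled_root_x (i : Fin (k + 1)) : IsLabelled ε p (x i) := (isLabelled_parent (x i)).symm

lemma isLabelled_root_y (i : Fin (k + 1)) : IsLabelled ε p (y i) := (isLabelled_parent (y i)).symm

lemma isLabelled_generator : IsLabelled ε (a : Vtx k) b := by
  simp [IsLabelled, label, halfLabel]

lemma isLabelled_root_digitSrc (i : Fin k) : IsLabelled ε p (digitSrc ε i) := by
  unfold digitSrc
  split_ifs
  exacts [(isLabelled_parent a).symm, isLabelled_self p]

lemma isLabelled_root_digitTgt (i : Fin k) : IsLabelled ε p (digitTgt ε i) := by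
  unfold digitTgt
  split_ifs
  exacts [(isLabelled_parent b).symm, isLabelled_self p]

lemma isLabelled_digit (i : Fin k) : IsLabelled ε (digitSrc ε i) (digitTgt ε i) := by
  unfold digitSrc digitTgt
  split_ifs
  exacts [isLabelled_generator, isLabelled_self p]

lemma edge_mul_of_mem_allTriples {u v w : Vtx k} (h : (u, v, w) ∈ allTriples ε k) :
    edge (telescope ε k).faces (tree k) u v * edge _ _ v w = edge _ _ u w :=
  isCocycle_edge.mul_of_mem (Or.inl h)

section

variable {u v w : Vtx k} (h : (u, v, w) ∈ openTriples ε k)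
include h

lemma edge_mul_of_mem_openTriples :
    edge (telescope ε k).faces (tree k) u v * edge _ _ v w = edge _ _ u w :=
  edge_mul_of_mem_allTriples (List.mem_cons_of_mem _ h)

lemma zpow_label_mul_of_mem_openTriples {G : Type*} [Group G] (g : G) :
    g ^ label ε u v * g ^ label ε v w = g ^ label ε u w := by
  rw [← zpow_add, label_of_mem_openTriples ε _ h]

lemma IsLabelled.trans (huv : IsLabelled ε u v) (hvw : IsLabelled ε v w) : IsLabelled ε u w := by
  rw [IsLabelled, ← edge_mul_of_mem_openTriples h, huv, hvw, zpow_label_mul_of_mem_openTriples h]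

lemma IsLabelled.of_left (huv : IsLabelled ε u v) (huw : IsLabelled ε u w) : IsLabelled ε v w := by
  rw [IsLabelled, ← mul_right_inj, edge_mul_of_mem_openTriples h, huv, huw,
    zpow_label_mul_of_mem_openTriples h]

lemma IsLabelled.of_right (hvw : IsLabelled ε v w) (huw : IsLabelled ε u w) :
    IsLabelled ε u v := by
  rw [IsLabelled, ← mul_left_inj, edge_mul_of_mem_openTriples h, hvw, huw,
    zpow_label_mul_of_mem_openTriples h]

end

variable (ε) in
/-- The three edges of a triple are labelled. -/
def TripleLabelled (t : Vtx k × Vtx k × Vtx k) : Prop :=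
  IsLabelled ε t.1 t.2.1 ∧ IsLabelled ε t.2.1 t.2.2 ∧ IsLabelled ε t.1 t.2.2

lemma tripleLabelled_of_mem_bottomTriples :
    ∀ t ∈ bottomTriples k, TripleLabelled ε t := by
  have hmem : ∀ t ∈ bottomTriples k, t ∈ openTriples ε k := fun _ => List.mem_append_left _
  simp only [bottomTriples, List.forall_mem_cons] at hmem ⊢
  obtain ⟨hpax, hpby, hcax, hcba, hcyb, hcxy, -⟩ := hmem
  have px := isLabelled_root_x (ε := ε) (0 : Fin (k + 1))
  have py := isLabelled_root_y (ε := ε) (0 : Fin (k + 1))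
  have pa := (isLabelled_parent (ε := ε) (a : Vtx k)).symm
  have pb := (isLabelled_parent (ε := ε) (b : Vtx k)).symm
  have ca := isLabelled_parent (ε := ε) (c : Vtx k)
  have ba := (isLabelled_generator (ε := ε) (k := k)).symm
  have ax := pa.of_left hpax px
  have yb := (pb.of_left hpby py).symm
  have cx := ca.trans hcax ax
  have cb := ba.of_right hcba ca
  have cy := yb.of_right hcyb cb
  have xy := cx.of_left hcxy cy
  exact ⟨⟨pa, ax, px⟩, ⟨pb, yb.symm, py⟩, ⟨ca, ax, cx⟩, ⟨cb, ba, ca⟩, ⟨cy, yb, cb⟩,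
    ⟨cx, xy, cy⟩, by simp⟩

lemma tripleLabelled_of_mem_stageTriples (i : Fin k)
    (xy : IsLabelled ε (x i.castSucc) (y i.castSucc)) :
    ∀ t ∈ stageTriples ε i, TripleLabelled ε t := by
  have hmem : ∀ t ∈ stageTriples ε i, t ∈ openTriples ε k := fun t ht =>
    List.mem_append_right _ (List.mem_flatMap.2 ⟨i, List.mem_finRange i, ht⟩)
  simp only [stageTriples, doublingTriples, digitTriples, List.cons_append, List.nil_append,
    List.forall_mem_cons] at hmem ⊢
  obtain ⟨hpyy₁, hpx₁x, hx₁xy, hxyy₁, hzx₁y, hzxy₁, hzx₁y₁, hpys, hptx, hzys, hzst, hztx, -⟩ :=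
    hmem
  have px := isLabelled_root_x (ε := ε) i.castSucc
  have py := isLabelled_root_y (ε := ε) i.castSucc
  have px₁ := isLabelled_root_x (ε := ε) i.succ
  have py₁ := isLabelled_root_y (ε := ε) i.succ
  have ps := isLabelled_root_digitSrc (ε := ε) i
  have pt := isLabelled_root_digitTgt (ε := ε) i
  have st := isLabelled_digit (ε := ε) i
  have zx₁ := isLabelled_parent (ε := ε) (z i)
  have yy₁ := py.of_left hpyy₁ py₁
  have x₁x := px₁.of_left hpx₁x px
  have ys := py.of_left hpys ps
  have tx := pt.of_left hptx px
  have x₁y := x₁x.trans hx₁xy xy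
  have xy₁ := xy.trans hxyy₁ yy₁
  have zy := zx₁.trans hzx₁y x₁y
  have zs := zy.trans hzys ys
  have zt := zs.trans hzst st
  have zx := zt.trans hztx tx
  have zy₁ := zx.trans hzxy₁ xy₁
  have x₁y₁ := zx₁.of_left hzx₁y₁ zy₁
  exact ⟨⟨py, yy₁, py₁⟩, ⟨px₁, x₁x, px⟩, ⟨x₁x, xy, x₁y⟩, ⟨xy, yy₁, xy₁⟩, ⟨zx₁, x₁y, zy⟩,
    ⟨zx, xy₁, zy₁⟩, ⟨zx₁, x₁y₁, zy₁⟩, ⟨py, ys, ps⟩, ⟨pt, tx, px⟩, ⟨zy, ys, zs⟩, ⟨zs, st, zt⟩,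
    ⟨zt, tx, zx⟩, by simp⟩

lemma isLabelled_x_y (i : Fin (k + 1)) : IsLabelled ε (x i) (y i) := by
  induction i using Fin.induction with
  | zero => exact (tripleLabelled_of_mem_bottomTriples (c, x 0, y 0) (by simp [bottomTriples])).2.1
  | succ i ih =>
    exact (tripleLabelled_of_mem_stageTriples i ih (z i, x i.succ, y i.succ)
      (by simp [stageTriples, doublingTriples])).2.1

lemma tripleLabelled_of_mem_generators {t : Vtx k × Vtx k × Vtx k} (ht : t ∈ generators ε k) :
    TripleLabelled ε t := by
  obtain ht | ⟨v, rfl⟩ := ht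
  · rw [allTriples, List.mem_cons, openTriples, List.mem_append, List.mem_flatMap] at ht
    obtain rfl | ht | ⟨i, -, ht⟩ := ht
    · exact ⟨isLabelled_root_x _, isLabelled_x_y _, isLabelled_root_y _⟩
    · exact tripleLabelled_of_mem_bottomTriples t ht
    · exact tripleLabelled_of_mem_stageTriples i (isLabelled_x_y _) t ht
  · exact ⟨isLabelled_parent v, isLabelled_self _, isLabelled_parent v⟩

lemma isLabelled_of_cofacial {u v : Vtx k} (h : Cofacial (telescope ε k).faces u v) :
    IsLabelled ε u v := by
  obtain ⟨t, ht, hu, hv⟩ := cofacial_tripleComplex_iff.1 h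
  obtain ⟨h₁₂, h₂₃, h₁₃⟩ := tripleLabelled_of_mem_generators ht
  obtain rfl | rfl | rfl := mem_simplex.1 hu <;> obtain rfl | rfl | rfl := mem_simplex.1 hv
  exacts [isLabelled_self _, h₁₂, h₁₃, h₁₂.symm, isLabelled_self _, h₂₃, h₁₃.symm, h₂₃.symm,
    isLabelled_self _]

lemma edge_pow_horner : edge (telescope ε k).faces (tree k) a b ^ horner ε k = 1 := by
  have htop := edge_mul_of_mem_allTriples (ε := ε) (k := k) List.mem_cons_self
  rw [isLabelled_root_x, isLabelled_x_y, isLabelled_root_y] at htop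
  simpa [label, halfLabel] using htop

lemma cofacial_generator : Cofacial (telescope ε k).faces a b :=
  cofacial_tripleComplex_iff.2 ⟨(c, b, a),
    Or.inl (List.mem_cons_of_mem _ (List.mem_append_left _ (by simp [bottomTriples]))),
    by simp [simplex], by simp [simplex]⟩

lemma isTwoComplexFor_telescope :
    IsTwoComplexFor (telescope ε k) (Multiplicative (ZMod (horner ε k))) := by
  refine ⟨fun s => card_le_three_of_mem_tripleComplex, pathConnectedSpace_telescope ε,
    vertex _ p, ⟨?_⟩⟩
  exact (edgeGroupEquiv (tree_le_skeletonGraph ε) (treeWalks k)).symm.trans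
    (edgeGroupEquivZMod (isCocycle_label ε) (fun _ _ => label_of_tree_adj ε) cofacial_generator
      (by simp [label, halfLabel]) (fun _ _ => isLabelled_of_cofacial) edge_pow_horner)

lemma kappa_zmod_horner_le (ε : ℕ → Bool) (k : ℕ) :
    kappa (Multiplicative (ZMod (horner ε k))) ≤ triangleBound ε k :=
  isTwoComplexFor_telescope.kappa_le.trans (Nat.cast_le.2 (numSimplices_telescope_le ε))

end Telescope

section LowerBound

lemma horner_congr {ε ε' : ℕ → Bool} {k : ℕ} (h : ∀ i < k, ε i = ε' i) :
    horner ε k = horner ε' k := by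
  induction k with
  | zero => rfl
  | succ k ih => rw [horner, horner, ih fun i hi => h i (by omega), h k k.lt_succ_self]

lemma triangleBound_congr {ε ε' : ℕ → Bool} {k : ℕ} (h : ∀ i < k, ε i = ε' i) :
    triangleBound ε k = triangleBound ε' k := by
  rw [triangleBound, triangleBound,
    Finset.sum_congr rfl fun i hi => by rw [h i (Finset.mem_range.1 hi)]]

lemma exists_horner_succ_eq (ε : ℕ → Bool) (k : ℕ) (d : Bool) :
    ∃ ε' : ℕ → Bool, horner ε' (k + 1) = 2 * horner ε k + d.toNat ∧
      triangleBound ε' (k + 1) ≤ triangleBound ε k + 12 := by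
  have hagree : ∀ i < k, Function.update ε k d i = ε i := fun i hi =>
    Function.update_of_ne hi.ne _ _
  refine ⟨Function.update ε k d, ?_, ?_⟩
  · rw [horner, horner_congr hagree, Function.update_self]
  · rw [← triangleBound_congr hagree, triangleBound, triangleBound, Finset.sum_range_succ,
      ← add_assoc]
    gcongr
    split_ifs <;> norm_num

lemma exists_horner_eq_and_triangleBound_le (m : ℕ) (hm : 2 ≤ m) :
    ∃ ε k, horner ε k = m ∧ 2 ^ triangleBound ε k ≤ 8 * m ^ 14 := by
  induction m using Nat.strong_induction_on with
  | _ m ih =>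
    obtain hlt | hge := lt_or_ge m 4
    · refine ⟨fun _ => decide (m = 3), 1, ?_⟩
      interval_cases m <;> simp [horner, triangleBound]
    · obtain ⟨ε, k, hhalf, hbound⟩ := ih (m / 2) (by omega) (by omega)
      obtain ⟨ε', hε', hle⟩ := exists_horner_succ_eq ε k (m.bodd)
      refine ⟨ε', k + 1, ?_, ?_⟩
      · rw [hε', hhalf, ← Nat.div2_val, add_comm, Nat.bodd_add_div2]
      · calc 2 ^ triangleBound ε' (k + 1)
            ≤ 2 ^ (triangleBound ε k + 14) := Nat.pow_le_pow_right two_pos (by omega)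
          _ = 2 ^ triangleBound ε k * 2 ^ 14 := pow_add _ _ _
          _ ≤ 8 * (m / 2) ^ 14 * 2 ^ 14 := Nat.mul_le_mul_right _ hbound
          _ = 8 * (m / 2 * 2) ^ 14 := by rw [mul_pow, mul_assoc]
          _ ≤ 8 * m ^ 14 := by
            gcongr
            exact Nat.div_mul_le_self m 2

lemma isTwoComplexFor_of_unique {ι : Type} [Fintype ι] [Unique ι]
    (K : AbstractSimplicialComplex ι) {G : Type*} [Group G] [Unique G] : IsTwoComplexFor K G := by
  have hsub : realization K ⊆ stdSimplex ℝ ι := fun _ hx => hx.1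
  have _ : Subsingleton (realization K) := (Set.inclusion_injective hsub).subsingleton
  have _ : Nonempty (realization K) := ⟨vertex K default⟩
  have _ : Unique (FundamentalGroup (realization K) (vertex K default)) := uniqueOfSubsingleton 1
  exact ⟨fun s _ => s.card_le_univ.trans (by simp), inferInstance, vertex K default, ⟨.ofUnique⟩⟩

lemma kappa_of_unique {G : Type*} [Group G] [Unique G] : kappa G = 0 := by
  have hno : {s | s ∈ (⊤ : AbstractSimplicialComplex Unit).faces ∧ s.card = 2 + 1} = ∅ :=
    Set.eq_empty_of_forall_notMem fun s hs => by
      have hle : s.card ≤ 1 := s.card_le_univ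
      have hcard : s.card = 2 + 1 := hs.2
      omega
  have hle := (isTwoComplexFor_of_unique (⊤ : AbstractSimplicialComplex Unit) (G := G)).kappa_le
  rwa [numSimplices, hno, Set.ncard_empty, Nat.cast_zero, nonpos_iff_eq_zero] at hle

lemma kappa_zmod_le {m T : ℕ} (hm : 0 < m) (h : 8 * m ^ 14 ≤ 2 ^ T) :
    kappa (Multiplicative (ZMod m)) ≤ T := by
  obtain rfl | hm₂ : m = 1 ∨ 2 ≤ m := by omega
  · have _ : Unique (Multiplicative (ZMod 1)) := inferInstanceAs (Unique (Fin 1))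
    exact kappa_of_unique.trans_le bot_le
  · obtain ⟨ε, k, rfl, hbound⟩ := exists_horner_eq_and_triangleBound_le m hm₂
    have hle : triangleBound ε k ≤ T := (Nat.pow_le_pow_iff_right one_lt_two).1 (hbound.trans h)
    exact (kappa_zmod_horner_le ε k).trans (Nat.cast_le.2 hle)

lemma hasNoFreeFactor_of_finite {G : Type} [Group G] [Finite G] : HasNoFreeFactor G := by
  refine fun K _ n hn => ⟨fun e => ?_⟩
  have _ : Nonempty (Fin n) := ⟨⟨0, hn⟩⟩
  have hinj : Function.Injective fun g : FreeGroup (Fin n) => e.symm (Monoid.Coprod.inr g) :=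
    e.symm.injective.comp Monoid.Coprod.inr_injective
  have _ : Finite (FreeGroup (Fin n)) := .of_injective _ hinj
  exact not_finite (FreeGroup (Fin n))

lemma groupClass_zmod_injective :
    Function.Injective fun m : ℕ => groupClass (Multiplicative (ZMod m)) := by
  intro m m' h
  obtain ⟨e⟩ := Quotient.exact h
  have hcard := Nat.card_congr e.groupIsoToMulEquiv.toEquiv
  exact (Nat.card_zmod m).symm.trans (hcard.trans (Nat.card_zmod m'))

lemma groupClass_zmod_mem_abelianGroupsUpTo {m T : ℕ} (hm : 0 < m) (h : 8 * m ^ 14 ≤ 2 ^ T) :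
    groupClass (Multiplicative (ZMod m)) ∈ abelianGroupsUpTo T :=
  have _ : NeZero m := ⟨hm.ne'⟩
  ⟨⟨_, _, rfl, hasNoFreeFactor_of_finite.hasFreeIndex_zero, kappa_zmod_le hm h⟩,
    _, _, rfl, inferInstance, mul_comm⟩

lemma eight_mul_pow_le_two_pow {m T : ℕ} (h : (m : ℝ) ≤ 2 ^ (((T : ℝ) - 3) / 14)) :
    8 * m ^ 14 ≤ 2 ^ T := by
  have hreal : 8 * (m : ℝ) ^ 14 ≤ 2 ^ T :=
    calc 8 * (m : ℝ) ^ 14 ≤ 8 * ((2 : ℝ) ^ (((T : ℝ) - 3) / 14)) ^ 14 := by gcongr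
      _ = 2 ^ (3 : ℝ) * 2 ^ ((T : ℝ) - 3) := by
        rw [← Real.rpow_mul_natCast zero_le_two, Nat.cast_ofNat, div_mul_cancel₀ _ (by norm_num)]
        norm_num
      _ = 2 ^ T := by rw [← Real.rpow_add two_pos, add_sub_cancel, Real.rpow_natCast]
  exact_mod_cast hreal

lemma floor_le_ncard_abelianGroupsUpTo (T : ℕ) :
    ⌊(2 : ℝ) ^ (((T : ℝ) - 3) / 14)⌋₊ ≤ (abelianGroupsUpTo T).ncard := by
  set N := ⌊(2 : ℝ) ^ (((T : ℝ) - 3) / 14)⌋₊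
  have hsub : (fun m => groupClass (Multiplicative (ZMod m))) '' Set.Icc 1 N ⊆
      abelianGroupsUpTo T := by
    rintro _ ⟨m, ⟨hm, hmN⟩, rfl⟩
    exact groupClass_zmod_mem_abelianGroupsUpTo hm
      (eight_mul_pow_le_two_pow ((Nat.le_floor_iff (by positivity)).1 hmN))
  calc N = (Set.Icc 1 N).ncard := by simp
    _ = ((fun m => groupClass (Multiplicative (ZMod m))) '' Set.Icc 1 N).ncard :=
      (Set.ncard_image_of_injective _ groupClass_zmod_injective).symm
    _ ≤ (abelianGroupsUpTo T).ncard :=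
      Set.ncard_le_ncard hsub ((groupsUpTo_finite T).subset fun _ hc => hc.1)

end LowerBound

end SimplicialComplexity

theorem mainTheorem3 (T : ℕ) (hT : 2 ≤ T) :
    (SimplicialComplexity.groupsUpTo T).Finite ∧
    ⌊(2 : ℝ) ^ (((T : ℝ) - 3) / 14)⌋₊ ≤ (SimplicialComplexity.abelianGroupsUpTo T).ncard ∧
    (SimplicialComplexity.abelianGroupsUpTo T).ncard ≤
      (SimplicialComplexity.groupsUpTo T).ncard ∧
    ((SimplicialComplexity.groupsUpTo T).ncard : ℝ) ≤
      (2 : ℝ) ^ (6 * (T : ℝ) * Real.logb 2 (T : ℝ)) :=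
  ⟨SimplicialComplexity.groupsUpTo_finite T,
    SimplicialComplexity.floor_le_ncard_abelianGroupsUpTo T,
    Set.ncard_le_ncard (fun _ hc => hc.1) (SimplicialComplexity.groupsUpTo_finite T),
    SimplicialComplexity.ncard_groupsUpTo_le_rpow hT⟩
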